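/- Let $\Omega=[0,1]^2$, $u(x,y)=x(1-x)y(1-y)$ and $f(x,y)=2\bigl(x(1-x)+y(1-y)\bigr)$, so that $-\Delta u=f$ in $\Omega$ and $u=0$ on $\partial\Omega$. For integers $m\ge n\ge 1$ let $\mathcal T_{n,m}$ be the triangulation of $\Omega$ generated by intersecting $[0,1]^2$ with the lines $y=\frac{j}{2m}$ ($1\le j\le 2m-1$), $y=\frac nm x+\frac jm$ ($1-m\le j\le m-1$) and $y=-\frac nm x+\frac jm$ ($1\le j\le 2m-1$). Equivalently, with $P_{i,j}=(\frac i{2n},\frac j{2m})$, its triangles are those with vertices $P_{i,j}$, $P_{\max(i-1,0),k}$, $P_{\min(i+1,2n),k}$, where $0\le i\le 2n$, $0\le j,k\le 2m$, $i\equiv j \pmod 2$ and $|j-k|=1$. Let $RT_{n,m}$ be the lowest-order Raviart–Thomas space on $\mathcal T_{n,m}$, without boundary conditions: the vector fields $\tau$ which on each triangle $\Delta\in\mathcal T_{n,m}$ have the form $\tau(x,y)=a_\Delta+b_\Delta\,(x,y)$ with $a_\Delta\in\mathbb R^2$, $b_\Delta\in\mathbb R$, and whose normal components are continuous across interior edges.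 Let $Q_{n,m}$ be the space of functions that are constant on each triangle. The mixed method for $-\Delta u=f$, $u|_{\partial\Omega}=0$, is to find $(\sigma_{n,m},p_{n,m})\in RT_{n,m}\times Q_{n,m}$ such that $$\int_\Omega \sigma_{n,m}\cdot\tau\,dx\,dy+\int_\Omega p_{n,m}\,\operatorname{div}\tau\,dx\,dy=0\quad\forall\,\tau\in RT_{n,m},\qquad \int_\Omega q\,\operatorname{div}\sigma_{n,m}\,dx\,dy=-\int_\Omega f q\,dx\,dy\quad\forall\, q\in Q_{n,m}.$$ There are constants $\varepsilon, C', C>0$, independent of $n$ and $m$, such that for all integers $m\ge n\ge 1$ the flux $\sigma_{n,m}$ of the mixed method exists, is unique, and satisfies $$\|\nabla u-\sigma_{n,m}\|_{L^2(\Omega)}\le C\min\Bigl(1,\frac m{n^2}\Bigr),$$ and, if in addition $n/m\le\varepsilon$, $$C'\min\Bigl(1,\frac m{n^2}\Bigr)\le\|\nabla u-\sigma_{n,m}\|_{L^2(\Omega)}.$$ -/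

import Mathlib

open MeasureTheory

noncomputable section

namespace RTMixed

/-- The Euclidean scalar product of two plane vectors. -/
def dot (v w : ℝ × ℝ) : ℝ := v.1 * w.1 + v.2 * w.2

/-- The gradient `(u_x, u_y)` of a scalar function on the plane. -/
def grad (u : ℝ × ℝ → ℝ) (x : ℝ × ℝ) : ℝ × ℝ :=
  (fderiv ℝ u x (1, 0), fderiv ℝ u x (0, 1))

/-- The divergence of a plane vector field. -/
def div (F : ℝ × ℝ → ℝ × ℝ) (x : ℝ × ℝ) : ℝ :=
  (fderiv ℝ F x (1, 0)).1 + (fderiv ℝ F x (0, 1)).2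

/-! ### The lowest-order Raviart-Thomas mixed method

A triangulation is a finite family `T` of triangles without hanging nodes, `T t 0`, `T t 1`,
`T t 2` being the vertices of the triangle with index `t`. -/

section General

variable {ι : Type*}

/-- The closed triangle with index `t`. -/
def cell (T : ι → Fin 3 → ℝ × ℝ) (t : ι) : Set (ℝ × ℝ) :=
  convexHull ℝ (Set.range (T t))

/-- The lowest-order Raviart-Thomas space, without boundary conditions. A piecewise polynomial
field is given by its polynomial pieces `τ t`, one for each triangle. Each piece has the form
`a + b x` with `a ∈ ℝ²` and `b ∈ ℝ`, and the normal components of the two pieces agree along the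
common edge of any two triangles; `(-(q.2 - p.2), q.1 - p.1)` is a normal to the edge `pq`. -/
def raviartThomas (T : ι → Fin 3 → ℝ × ℝ) : Set (ι → ℝ × ℝ → ℝ × ℝ) :=
  {τ | (∀ t, ∃ (a : ℝ × ℝ) (b : ℝ), ∀ x, τ t x = a + b • x) ∧
    ∀ s t, ∀ p ∈ Set.range (T s) ∩ Set.range (T t), ∀ q ∈ Set.range (T s) ∩ Set.range (T t),
      ∀ x ∈ segment ℝ p q,
        dot (τ s x) (-(q.2 - p.2), q.1 - p.1) = dot (τ t x) (-(q.2 - p.2), q.1 - p.1)}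

variable [Fintype ι]

/-- `(σ, p)` solves the mixed discretization of `-Δ u = f`, `u = 0` on the boundary, with lowest
order Raviart-Thomas fluxes `σ` (approximating `∇ u`) and piecewise constants `p`
(approximating `u`):
`(σ, τ) + (p, div τ) = 0` for all Raviart-Thomas fields `τ`, and
`(div σ, q) = -(f, q)` for all piecewise constants `q`. -/
def IsMixedSolution (T : ι → Fin 3 → ℝ × ℝ) (f : ℝ × ℝ → ℝ)
    (σ : ι → ℝ × ℝ → ℝ × ℝ) (p : ι → ℝ) : Prop :=
  σ ∈ raviartThomas T ∧
  (∀ τ ∈ raviartThomas T,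
    (∑ t, ∫ x in cell T t, dot (σ t x) (τ t x)) + ∑ t, ∫ x in cell T t, p t * div (τ t) x = 0) ∧
  ∀ q : ι → ℝ,
    ∑ t, ∫ x in cell T t, div (σ t) x * q t = -∑ t, ∫ x in cell T t, f x * q t

/-- `σ` is the flux component of a solution of the mixed method. -/
def IsMixedFlux (T : ι → Fin 3 → ℝ × ℝ) (f : ℝ × ℝ → ℝ) (σ : ι → ℝ × ℝ → ℝ × ℝ) : Prop :=
  ∃ p : ι → ℝ, IsMixedSolution T f σ p

/-- The error `‖∇ u - σ‖` in `L²` of the triangulated domain. -/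
def fluxError (T : ι → Fin 3 → ℝ × ℝ) (u : ℝ × ℝ → ℝ) (σ : ι → ℝ × ℝ → ℝ × ℝ) : ℝ :=
  Real.sqrt (∑ t, ∫ x in cell T t, dot (grad u x - σ t x) (grad u x - σ t x))

end General

/-! ### The triangulations of the unit square -/

/-- The point `P_{i,j} = (i / (2n), j / (2m))`. -/
def gridPoint (n m i j : ℕ) : ℝ × ℝ := ((i : ℝ) / (2 * n), (j : ℝ) / (2 * m))

/-- Indices of the triangles: a triple `(i, j, k)` stands for the triangle with apex `P_{i,j}`,
where `0 ≤ i ≤ 2n`, `0 ≤ j ≤ 2m` and `i ≡ j` modulo 2, whose horizontal side lies on the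
neighbouring line `y = k / (2m)`, where `0 ≤ k ≤ 2m` and `k = j + 1` or `k = j - 1`. -/
abbrev TriIndex (n m : ℕ) : Type :=
  {t : Fin (2 * n + 1) × Fin (2 * m + 1) × Fin (2 * m + 1) //
    (t.1 : ℕ) % 2 = (t.2.1 : ℕ) % 2 ∧
      ((t.2.2 : ℕ) = (t.2.1 : ℕ) + 1 ∨ (t.2.1 : ℕ) = (t.2.2 : ℕ) + 1)}

/-- The triangulation `𝒯_{n,m}` of `[0,1]²`, cut out by the lines `y = j / (2m)` and
`y = ± (n / m) x + j / m`. The horizontal side of the triangle `(i, j, k)` joins `P_{i-1,k}` to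
`P_{i+1,k}`, where `i - 1` is replaced by `0` if `i = 0` (this is the truncated subtraction) and
`i + 1` by `2n` if `i = 2n`: these are the right-angled triangles along the vertical sides. -/
def triangulation (n m : ℕ) (t : TriIndex n m) : Fin 3 → ℝ × ℝ :=
  ![gridPoint n m t.1.1 t.1.2.1,
    gridPoint n m ((t.1.1 : ℕ) - 1) t.1.2.2,
    gridPoint n m (min ((t.1.1 : ℕ) + 1) (2 * n)) t.1.2.2]

/-! ### The model problem -/

/-- The solution `u(x, y) = x (1 - x) y (1 - y)`. -/
def modelU (x : ℝ × ℝ) : ℝ := x.1 * (1 - x.1) * x.2 * (1 - x.2)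

/-- The right-hand side `f(x, y) = 2 (x (1 - x) + y (1 - y))`, which is `-Δ u`. -/
def modelF (x : ℝ × ℝ) : ℝ := 2 * (x.1 * (1 - x.1) + x.2 * (1 - x.2))

end RTMixed

end

/-! Write X = `stepX n`, Y = `stepY m` and κ = X²/Y = m/(2n²); the error has to be compared with
min(1, κ).

Algebra. The divergence of a Raviart-Thomas field is constant on each triangle, so the second
equation prescribes it. Fields with the same divergences differ by an element of `constFields`, and
the first equation makes σ orthogonal to `constFields`. This gives uniqueness. It also gives
existence once one field with the right divergences is known: subtract its projection onto
`constFields` and recover p as a Lagrange multiplier (`exists_pressure`).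

Upper bound. Let τ be a Raviart-Thomas field with the divergences of σ, let a = σ - τ, and let g be
a piecewise constant field orthogonal to `constFields`. Then (a, a) = (g - τ, a), so ‖a‖ ≤ ‖g - τ‖.
For the bound by κ, τ interpolates ∇u and g is the piecewise gradient of the nonconforming
(Crouzeix-Raviart) interpolant of u; it is orthogonal because the values at side midpoints are
shared by neighbours and vanish on the boundary. Both lie within O(κ) of ∇u: errors of order X² are
divided by the height Y. For the uniform bound, g = 0 and τ interpolates a purely horizontal field
of divergence -f, which sends no flux through the long horizontal sides.

Lower bound. The error is tested with the piecewise gradient of a nonconforming function v that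
vanishes at the midpoints of horizontal sides and, along each row, takes values of size X and
alternating sign at the midpoints of the slanted sides, with envelope ϕ(x) w(y), where ϕ(x) =
x(1-x)(1-2x) and w(y) is about 1-2y. The alternation cancels against the alternating direction of
the triangles: the vertical derivative of v is about -κ ϕ'(x) w(y), without oscillation, while the
horizontal one is bounded and oscillates. Since v = O(X), integration by parts gives (σ, ∇v) = O(X),
and the horizontal part of (∇u, ∇v) is O(X) by summation by parts. The vertical part is about κ
∫ϕ(x)(1-2x)dx ∫(1-2y)²dy, a positive multiple of κ. As X = (n/m)κ, the O(X) terms are absorbed for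
small n/m; dividing by ‖∇v‖ = O(1+κ) yields min(1, κ). -/

namespace RTMixed

/-! ### Exact integration of quadratic polynomials over triangles -/

/-- The reference triangle with vertices `(0, 0)`, `(1, 0)`, `(0, 1)`. -/
def refTriangle : Set (ℝ × ℝ) := {s | 0 ≤ s.1 ∧ 0 ≤ s.2 ∧ s.1 + s.2 ≤ 1}

lemma isClosed_refTriangle : IsClosed refTriangle :=
  (isClosed_le continuous_const continuous_fst).inter
    ((isClosed_le continuous_const continuous_snd).inter
      (isClosed_le (continuous_fst.add continuous_snd) continuous_const))

lemma isCompact_refTriangle : IsCompact refTriangle := by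
  refine (isCompact_Icc (a := ((0, 0) : ℝ × ℝ)) (b := (1, 1))).of_isClosed_subset
    isClosed_refTriangle ?_
  rintro ⟨x, y⟩ ⟨hx, hy, hxy⟩
  simp only at hx hy hxy
  exact ⟨⟨hx, hy⟩, ⟨by simp only; linarith, by simp only; linarith⟩⟩

lemma integral_refTriangle {q : ℝ × ℝ → ℝ} (hq : Continuous q) :
    ∫ s in refTriangle, q s = ∫ x in (0 : ℝ)..1, ∫ y in (0 : ℝ)..(1 - x), q (x, y) := by
  have hm : MeasurableSet refTriangle := isClosed_refTriangle.measurableSet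
  have hint : Integrable (refTriangle.indicator q) (volume : Measure (ℝ × ℝ)) :=
    (hq.continuousOn.integrableOn_compact isCompact_refTriangle).integrable_indicator hm
  rw [← integral_indicator hm, Measure.volume_eq_prod, integral_prod _ hint,
    intervalIntegral.integral_of_le zero_le_one, ← integral_Icc_eq_integral_Ioc,
    ← integral_indicator measurableSet_Icc]
  congr 1
  funext x
  by_cases hx : x ∈ Set.Icc (0 : ℝ) 1
  · rw [Set.indicator_of_mem hx, intervalIntegral.integral_of_le (by linarith [hx.2]),
      ← integral_Icc_eq_integral_Ioc, ← integral_indicator measurableSet_Icc]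
    congr 1
    funext y
    have : (x, y) ∈ refTriangle ↔ y ∈ Set.Icc 0 (1 - x) := by
      simp only [refTriangle, Set.mem_ofPred_eq, Set.mem_Icc]
      constructor
      · rintro ⟨_, h2, h3⟩; exact ⟨h2, by linarith⟩
      · rintro ⟨h2, h3⟩; exact ⟨hx.1, h2, by linarith⟩
    by_cases hy : y ∈ Set.Icc 0 (1 - x)
    · rw [Set.indicator_of_mem hy, Set.indicator_of_mem (this.2 hy)]
    · rw [Set.indicator_of_notMem hy, Set.indicator_of_notMem (mt this.1 hy)]
  · rw [Set.indicator_of_notMem hx]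
    have : ∀ y, refTriangle.indicator q (x, y) = 0 := by
      intro y
      refine Set.indicator_of_notMem ?_ _
      rintro ⟨h1, h2, h3⟩
      exact hx ⟨h1, by simp only at h1 h2 h3; linarith⟩
    simp [this]

lemma integral_refTriangle_quadratic (c₀ c₁ c₂ c₃ c₄ c₅ : ℝ) :
    ∫ s in refTriangle, (c₀ + c₁ * s.1 + c₂ * s.2 + c₃ * s.1 ^ 2 + c₄ * s.1 * s.2 + c₅ * s.2 ^ 2)
      = c₀ / 2 + (c₁ + c₂) / 6 + c₃ / 12 + c₄ / 24 + c₅ / 12 := by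
  rw [integral_refTriangle (by fun_prop)]
  have inner : ∀ x : ℝ, ∫ y in (0 : ℝ)..(1 - x),
      (c₀ + c₁ * x + c₂ * y + c₃ * x ^ 2 + c₄ * x * y + c₅ * y ^ 2)
      = (c₀ + c₁ * x + c₃ * x ^ 2) * (1 - x) + (c₂ + c₄ * x) * (1 - x) ^ 2 / 2
        + c₅ * (1 - x) ^ 3 / 3 := by
    intro x
    rw [intervalIntegral.integral_eq_sub_of_hasDerivAt (f := fun y =>
      (c₀ + c₁ * x + c₃ * x ^ 2) * y + (c₂ + c₄ * x) * y ^ 2 / 2 + c₅ * y ^ 3 / 3)]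
    · simp
    · intro y _
      have h2 := (((hasDerivAt_pow 2 y).const_mul (c₂ + c₄ * x)).div_const 2)
      have h3 := (((hasDerivAt_pow 3 y).const_mul c₅).div_const 3)
      have h1 := (hasDerivAt_id y).const_mul (c₀ + c₁ * x + c₃ * x ^ 2)
      refine ((h1.add h2).add h3).congr_deriv ?_
      norm_num
      ring
    · exact Continuous.intervalIntegrable (by fun_prop) _ _
  simp only [inner]
  rw [intervalIntegral.integral_eq_sub_of_hasDerivAt (f := fun x =>
      (c₀ + c₂ / 2 + c₅ / 3) * x + (c₁ - c₀ - c₂ + c₄ / 2 - c₅) * x ^ 2 / 2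
      + (c₃ - c₁ + c₂ / 2 - c₄ + c₅) * x ^ 3 / 3 + (- c₃ + c₄ / 2 - c₅ / 3) * x ^ 4 / 4)]
  · norm_num
    ring
  · intro x _
    have h1 := (hasDerivAt_id x).const_mul (c₀ + c₂ / 2 + c₅ / 3)
    have h2 := (((hasDerivAt_pow 2 x).const_mul (c₁ - c₀ - c₂ + c₄ / 2 - c₅)).div_const 2)
    have h3 := (((hasDerivAt_pow 3 x).const_mul (c₃ - c₁ + c₂ / 2 - c₄ + c₅)).div_const 3)
    have h4 := (((hasDerivAt_pow 4 x).const_mul (- c₃ + c₄ / 2 - c₅ / 3)).div_const 4)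
    refine (((h1.add h2).add h3).add h4).congr_deriv ?_
    norm_num
    ring
  · exact Continuous.intervalIntegrable (by fun_prop) _ _

/-- Twice the signed area of the triangle `ABC`. -/
def orient (A B C : ℝ × ℝ) : ℝ := (B.1 - A.1) * (C.2 - A.2) - (B.2 - A.2) * (C.1 - A.1)

/-- The affine map that takes the reference triangle to the triangle `ABC`. -/
def refMap (A B C : ℝ × ℝ) (s : ℝ × ℝ) : ℝ × ℝ := A + s.1 • (B - A) + s.2 • (C - A)

lemma refMap_image (T : Fin 3 → ℝ × ℝ) :
    refMap (T 0) (T 1) (T 2) '' refTriangle = convexHull ℝ (Set.range T) := by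
  apply Set.Subset.antisymm
  · rintro _ ⟨⟨x, y⟩, ⟨hx, hy, hxy⟩, rfl⟩
    simp only at hx hy hxy
    have h := (convex_convexHull ℝ (Set.range T)).sum_mem (t := Finset.univ)
      (w := ![1 - x - y, x, y]) (z := T) ?_ ?_ (fun i _ => subset_convexHull ℝ _ ⟨i, rfl⟩)
    · convert! h using 1
      simp only [refMap, Fin.sum_univ_three]
      ext <;> simp <;> ring
    · intro i _
      fin_cases i <;> simp <;> linarith
    · simp [Fin.sum_univ_three]
      ring
  · refine convexHull_min ?_ ?_
    · rintro _ ⟨i, rfl⟩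
      fin_cases i
      · exact ⟨(0, 0), by simp [refTriangle], by simp [refMap]⟩
      · exact ⟨(1, 0), by simp [refTriangle], by simp [refMap]⟩
      · exact ⟨(0, 1), by simp [refTriangle], by simp [refMap]⟩
    · rintro _ ⟨s, ⟨hs1, hs2, hs3⟩, rfl⟩ _ ⟨t, ⟨ht1, ht2, ht3⟩, rfl⟩ a b ha hb hab
      refine ⟨a • s + b • t, ⟨?_, ?_, ?_⟩, ?_⟩
      · simp; positivity
      · simp; positivity
      · simp only [Prod.fst_add, Prod.smul_fst, smul_eq_mul, Prod.snd_add, Prod.smul_snd]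
        nlinarith
      · obtain rfl : b = 1 - a := by linarith
        simp only [refMap]
        ext <;> simp <;> ring

/-! ### Integrals over a single triangle. -/

section Cell

variable {ι : Type*} (T : ι → Fin 3 → ℝ × ℝ) (t : ι)

lemma cell_eq_image : cell T t = refMap (T t 0) (T t 1) (T t 2) '' refTriangle :=
  (refMap_image (T t)).symm

lemma isCompact_cell : IsCompact (cell T t) := by
  rw [cell_eq_image]
  refine isCompact_refTriangle.image ?_
  unfold refMap
  fun_prop

lemma measurableSet_cell : MeasurableSet (cell T t) := (isCompact_cell T t).measurableSet

lemma integrableOn_cell {g : ℝ × ℝ → ℝ} (hg : Continuous g) : IntegrableOn g (cell T t) :=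
  hg.continuousOn.integrableOn_compact (isCompact_cell T t)

/-- The area of the triangle with index `t`. -/
noncomputable def area : ℝ := |orient (T t 0) (T t 1) (T t 2)| / 2

/-- The midpoints of the edges, the `i`-th one being opposite to the `i`-th vertex. -/
noncomputable def mid (T : ι → Fin 3 → ℝ × ℝ) (t : ι) : Fin 3 → ℝ × ℝ :=
  ![(1 / 2 : ℝ) • (T t 1 + T t 2), (1 / 2 : ℝ) • (T t 2 + T t 0), (1 / 2 : ℝ) • (T t 0 + T t 1)]

/-- The midpoint rule is exact for quadratic polynomials. -/
lemma integral_cell_quadratic {q : ℝ × ℝ → ℝ} (hD : orient (T t 0) (T t 1) (T t 2) ≠ 0)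
    (c₀ c₁ c₂ c₃ c₄ c₅ : ℝ)
    (hq : ∀ x, q x = c₀ + c₁ * x.1 + c₂ * x.2 + c₃ * x.1 ^ 2 + c₄ * x.1 * x.2 + c₅ * x.2 ^ 2) :
    ∫ x in cell T t, q x = area T t / 3 * (q (mid T t 0) + q (mid T t 1) + q (mid T t 2)) := by
  rw [cell_eq_image]
  unfold area mid
  generalize T t 0 = A at *
  generalize T t 1 = B at *
  generalize T t 2 = C at *
  let φ : ℝ × ℝ →L[ℝ] ℝ × ℝ := (Matrix.toLin (.finTwoProd ℝ) (.finTwoProd ℝ)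
    !![B.1 - A.1, C.1 - A.1; B.2 - A.2, C.2 - A.2]).toContinuousLinearMap
  have hφ : ∀ s, refMap A B C s = A + φ s := by
    intro s
    simp only [φ, Matrix.toLin_finTwoProd_toContinuousLinearMap, refMap]
    ext <;> simp <;> ring
  have hdet : φ.det = orient A B C := by
    simp only [φ, LinearMap.det_toContinuousLinearMap, LinearMap.det_toLin,
      Matrix.det_fin_two_of, orient]
    ring
  have hinj : Function.Injective φ := by
    have := (LinearMap.equivOfDetNeZero (φ : ℝ × ℝ →ₗ[ℝ] ℝ × ℝ) (by rw [← hdet] at hD; exact hD)).injective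
    exact this
  rw [integral_image_eq_integral_abs_det_fderiv_smul volume isClosed_refTriangle.measurableSet
    (f' := fun _ => φ)]
  -- The pulled-back quadratic is written out in reference coordinates, so that the closed formula
  -- on the reference triangle applies.
  · have : ∀ s, |φ.det| • q (refMap A B C s) = |orient A B C| *
        ((c₀ + c₁ * A.1 + c₂ * A.2 + c₃ * A.1 ^ 2 + c₄ * A.1 * A.2 + c₅ * A.2 ^ 2)
        + (c₁ * (B.1 - A.1) + c₂ * (B.2 - A.2) + 2 * c₃ * A.1 * (B.1 - A.1)
          + c₄ * (A.1 * (B.2 - A.2) + (B.1 - A.1) * A.2) + 2 * c₅ * A.2 * (B.2 - A.2)) * s.1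
        + (c₁ * (C.1 - A.1) + c₂ * (C.2 - A.2) + 2 * c₃ * A.1 * (C.1 - A.1)
          + c₄ * (A.1 * (C.2 - A.2) + (C.1 - A.1) * A.2) + 2 * c₅ * A.2 * (C.2 - A.2)) * s.2
        + (c₃ * (B.1 - A.1) ^ 2 + c₄ * (B.1 - A.1) * (B.2 - A.2) + c₅ * (B.2 - A.2) ^ 2) * s.1 ^ 2
        + (2 * c₃ * (B.1 - A.1) * (C.1 - A.1)
          + c₄ * ((B.1 - A.1) * (C.2 - A.2) + (B.2 - A.2) * (C.1 - A.1))
          + 2 * c₅ * (B.2 - A.2) * (C.2 - A.2)) * s.1 * s.2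
        + (c₃ * (C.1 - A.1) ^ 2 + c₄ * (C.1 - A.1) * (C.2 - A.2) + c₅ * (C.2 - A.2) ^ 2)
          * s.2 ^ 2) := by
      intro s
      rw [hdet, hq]
      simp only [refMap, smul_eq_mul, Prod.fst_add, Prod.snd_add, Prod.smul_fst, Prod.smul_snd,
        Prod.fst_sub, Prod.snd_sub]
      ring
    simp only [this]
    rw [integral_const_mul, integral_refTriangle_quadratic, hq, hq, hq]
    simp
    ring
  · intro s _
    have := (φ.hasFDerivAt (x := s)).const_add A
    exact (this.congr_of_eventuallyEq (Filter.Eventually.of_forall hφ)).hasFDerivWithinAt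
  · intro s _ s' _ h
    rw [hφ, hφ] at h
    exact hinj (add_left_cancel h)

lemma integral_cell_const (hD : orient (T t 0) (T t 1) (T t 2) ≠ 0) (c : ℝ) :
    ∫ _ in cell T t, c = area T t * c := by
  rw [integral_cell_quadratic T t hD c 0 0 0 0 0 (by simp)]
  ring

lemma abs_integral_cell_le (hD : orient (T t 0) (T t 1) (T t 2) ≠ 0) {g : ℝ × ℝ → ℝ} {M : ℝ}
    (hg : ∀ x ∈ cell T t, |g x| ≤ M) : |∫ x in cell T t, g x| ≤ area T t * M := by
  have hfin : volume (cell T t) < ⊤ := (isCompact_cell T t).measure_lt_top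
  have h := norm_setIntegral_le_of_norm_le_const (f := g) (C := M) hfin (fun x hx => hg x hx)
  have h1 := integral_cell_const T t hD 1
  rw [setIntegral_const, smul_eq_mul] at h1
  rw [mul_one, mul_one] at h1
  rw [h1, mul_comm] at h
  exact h

lemma integral_cell_nonneg {g : ℝ × ℝ → ℝ} (hg : ∀ x, 0 ≤ g x) : 0 ≤ ∫ x in cell T t, g x :=
  integral_nonneg hg

end Cell

end RTMixed

namespace RTMixed

/-! ### Raviart-Thomas fields and their interpolation -/

lemma dot_add_left (v w z : ℝ × ℝ) : dot (v + w) z = dot v z + dot w z := by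
  simp only [dot, Prod.fst_add, Prod.snd_add]; ring

lemma dot_smul_left (c : ℝ) (v z : ℝ × ℝ) : dot (c • v) z = c * dot v z := by
  simp only [dot, Prod.smul_fst, Prod.smul_snd, smul_eq_mul]; ring

lemma dot_sub_left (v w z : ℝ × ℝ) : dot (v - w) z = dot v z - dot w z := by
  simp only [dot, Prod.fst_sub, Prod.snd_sub]; ring

lemma dot_comm (v w : ℝ × ℝ) : dot v w = dot w v := by
  simp only [dot]; ring

lemma dot_self_nonneg (v : ℝ × ℝ) : 0 ≤ dot v v :=
  add_nonneg (mul_self_nonneg _) (mul_self_nonneg _)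

lemma dot_self_eq_zero {v : ℝ × ℝ} (h : dot v v = 0) : v = 0 := by
  simp only [dot] at h
  have h1 := mul_self_nonneg v.1
  have h2 := mul_self_nonneg v.2
  ext
  · exact mul_self_eq_zero.1 (by linarith)
  · exact mul_self_eq_zero.1 (by linarith)

lemma continuous_dot {F G : ℝ × ℝ → ℝ × ℝ} (hF : Continuous F) (hG : Continuous G) :
    Continuous fun x => dot (F x) (G x) := by
  unfold dot
  fun_prop

lemma div_affine {τ : ℝ × ℝ → ℝ × ℝ} {a : ℝ × ℝ} {b : ℝ} (h : ∀ x, τ x = a + b • x) (x : ℝ × ℝ) :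
    div τ x = 2 * b := by
  have h1 : HasFDerivAt τ (b • ContinuousLinearMap.id ℝ (ℝ × ℝ)) x := by
    obtain rfl : τ = fun x => a + b • x := funext h
    exact ((hasFDerivAt_id x).const_smul b).const_add a
  simp only [div, h1.fderiv]
  simp
  ring

/-- The normal to the edge `pq` that is used in the definition of the Raviart-Thomas space. -/
def normal (p q : ℝ × ℝ) : ℝ × ℝ := (-(q.2 - p.2), q.1 - p.1)

lemma normal_swap (p q : ℝ × ℝ) : normal q p = (-1 : ℝ) • normal p q := by
  ext <;> simp [normal]

/-- The Raviart-Thomas field on the triangle `ABC` whose flux through the edge `pq` is `F p q`. -/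
noncomputable def rtInterp (F : ℝ × ℝ → ℝ × ℝ → ℝ) (A B C x : ℝ × ℝ) : ℝ × ℝ :=
  (-(1 / orient A B C)) • (F A B • (x - C) + F B C • (x - A) + F C A • (x - B))

lemma rtInterp_eq (F : ℝ × ℝ → ℝ × ℝ → ℝ) (A B C x : ℝ × ℝ) :
    rtInterp F A B C x = (1 / orient A B C) • (F A B • C + F B C • A + F C A • B)
      + (-(F A B + F B C + F C A) / orient A B C) • x := by
  ext <;> simp [rtInterp] <;> ring

/-- The flux of `ψ` through the edge `pq` by Simpson's rule. -/
noncomputable def edgeFlux (ψ : ℝ × ℝ → ℝ × ℝ) (p q : ℝ × ℝ) : ℝ :=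
  dot ((1 / 6 : ℝ) • (ψ p + (4 : ℝ) • ψ ((1 / 2 : ℝ) • (p + q)) + ψ q)) (normal p q)

lemma edgeFlux_swap (ψ : ℝ × ℝ → ℝ × ℝ) (p q : ℝ × ℝ) : edgeFlux ψ q p = -edgeFlux ψ p q := by
  rw [edgeFlux, edgeFlux, normal_swap, dot_comm, dot_smul_left, dot_comm, add_comm q p,
    add_right_comm, add_comm (ψ q), ← add_right_comm]
  ring

/-- Interpolation reproduces constants. Hence the deviation of an interpolant from a constant is
controlled by fluxes of the deviation only. -/
lemma rtInterp_edgeFlux_sub_const (ψ : ℝ × ℝ → ℝ × ℝ) (c A B C x : ℝ × ℝ)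
    (hD : orient A B C ≠ 0) :
    rtInterp (edgeFlux ψ) A B C x - c = rtInterp (edgeFlux fun y => ψ y - c) A B C x := by
  unfold orient at hD
  ext <;> simp [rtInterp, edgeFlux, dot, normal, orient] <;> field_simp <;> ring

/-! ### The Raviart-Thomas space and its divergence-free part. -/

section Space

variable {ι : Type*} (T : ι → Fin 3 → ℝ × ℝ)

/-- All triangles have positive area. -/
def Nondegenerate : Prop := ∀ t, orient (T t 0) (T t 1) (T t 2) ≠ 0

variable {T}

lemma Nondegenerate.area_pos (hT : Nondegenerate T) (t : ι) : 0 < area T t :=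
  half_pos (abs_pos.2 (hT t))

/-- On the side AB the vectors x - A and x - B are tangential, and x - C has a constant normal
component, equal to the orientation up to sign. Each term of `rtInterp` therefore feeds exactly one
side. -/
lemma dot_rtInterp_normal {F : ℝ × ℝ → ℝ × ℝ → ℝ} (hF : ∀ p q, F q p = -F p q)
    (hT : Nondegenerate T) (t : ι) {p q x : ℝ × ℝ} (hp : p ∈ Set.range (T t))
    (hq : q ∈ Set.range (T t)) (hx : x ∈ segment ℝ p q) :
    dot (rtInterp F (T t 0) (T t 1) (T t 2) x) (-(q.2 - p.2), q.1 - p.1) = F p q := by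
  have hD := hT t
  obtain ⟨i, rfl⟩ := hp
  obtain ⟨j, rfl⟩ := hq
  obtain ⟨a, b, -, -, hab, rfl⟩ := hx
  obtain rfl : a = 1 - b := by linarith
  have h0 : ∀ p, F p p = 0 := fun p => by linarith [hF p p]
  have hBA := hF (T t 0) (T t 1)
  have hCB := hF (T t 1) (T t 2)
  have hCA := hF (T t 2) (T t 0)
  unfold orient at hD
  fin_cases i <;> fin_cases j <;>
    simp [rtInterp, dot, orient, h0, hBA, hCB, hCA] <;> field_simp <;> ring

/-- The data are attached to ordered pairs of points and not to triangles, so the two neighbours of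
a side see the same flux. -/
lemma rtInterp_mem_raviartThomas {F : ℝ × ℝ → ℝ × ℝ → ℝ} (hF : ∀ p q, F q p = -F p q)
    (hT : Nondegenerate T) :
    (fun t => rtInterp F (T t 0) (T t 1) (T t 2)) ∈ raviartThomas T := by
  refine ⟨fun t => ⟨_, _, rtInterp_eq F _ _ _⟩, ?_⟩
  intro s t p hp q hq x hx
  rw [dot_rtInterp_normal hF hT s hp.1 hq.1 hx, dot_rtInterp_normal hF hT t hp.2 hq.2 hx]

lemma continuous_of_mem {τ : ι → ℝ × ℝ → ℝ × ℝ} (hτ : τ ∈ raviartThomas T) (t : ι) :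
    Continuous (τ t) := by
  obtain ⟨a, b, h⟩ := hτ.1 t
  rw [funext h]
  fun_prop

variable (T) in
/-- The Raviart-Thomas space as a vector space. -/
def raviartThomasSubmodule : Submodule ℝ (ι → ℝ × ℝ → ℝ × ℝ) where
  carrier := raviartThomas T
  zero_mem' := ⟨fun t => ⟨0, 0, by simp⟩, by simp [dot]⟩
  add_mem' := by
    rintro σ τ ⟨hσ, hσ'⟩ ⟨hτ, hτ'⟩
    refine ⟨fun t => ?_, ?_⟩
    · obtain ⟨a, b, h⟩ := hσ t
      obtain ⟨a', b', h'⟩ := hτ t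
      exact ⟨a + a', b + b', fun x => by simp only [Pi.add_apply, h, h', add_smul]; abel⟩
    · intro s t p hp q hq x hx
      simp only [Pi.add_apply, dot_add_left, hσ' s t p hp q hq x hx, hτ' s t p hp q hq x hx]
  smul_mem' := by
    rintro c σ ⟨hσ, hσ'⟩
    refine ⟨fun t => ?_, ?_⟩
    · obtain ⟨a, b, h⟩ := hσ t
      exact ⟨c • a, c * b, fun x => by simp only [Pi.smul_apply, h, smul_add, mul_smul]⟩
    · intro s t p hp q hq x hx
      simp only [Pi.smul_apply, dot_smul_left, hσ' s t p hp q hq x hx]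

lemma sub_mem_raviartThomas {σ τ : ι → ℝ × ℝ → ℝ × ℝ} (hσ : σ ∈ raviartThomas T)
    (hτ : τ ∈ raviartThomas T) : σ - τ ∈ raviartThomas T :=
  (raviartThomasSubmodule T).sub_mem hσ hτ

lemma integral_div_affine (hT : Nondegenerate T) {τ : ι → ℝ × ℝ → ℝ × ℝ} {t : ι} {a : ℝ × ℝ}
    {b : ℝ} (h : ∀ x, τ t x = a + b • x) : ∫ x in cell T t, div (τ t) x = area T t * (2 * b) := by
  simp only [div_affine h]
  exact integral_cell_const T t (hT t) _

variable (T) in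
/-- The piecewise constant fields in the Raviart-Thomas space; these are the fields without
divergence. -/
def constFields : Submodule ℝ (ι → ℝ × ℝ) where
  carrier := {a | (fun t _ => a t) ∈ raviartThomas T}
  zero_mem' := (raviartThomasSubmodule T).zero_mem
  add_mem' := fun {_ _} ha hb => (raviartThomasSubmodule T).add_mem ha hb
  smul_mem' := fun c _ ha => (raviartThomasSubmodule T).smul_mem c ha

lemma integral_dot_const {F : ℝ × ℝ → ℝ × ℝ} (hF : Continuous F) (t : ι) (a : ℝ × ℝ) :
    ∫ x in cell T t, dot (F x) a
      = dot (∫ x in cell T t, (F x).1, ∫ x in cell T t, (F x).2) a := by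
  simp only [dot]
  rw [integral_add, integral_mul_const, integral_mul_const]
  · exact integrableOn_cell T t (by fun_prop)
  · exact integrableOn_cell T t (by fun_prop)

lemma integral_dot_add {F G H : ℝ × ℝ → ℝ × ℝ} (hF : Continuous F) (hG : Continuous G)
    (hH : Continuous H) (t : ι) : ∫ x in cell T t, dot (F x + G x) (H x)
      = (∫ x in cell T t, dot (F x) (H x)) + ∫ x in cell T t, dot (G x) (H x) := by
  simp only [dot_add_left]
  exact integral_add (integrableOn_cell T t (continuous_dot hF hH))
    (integrableOn_cell T t (continuous_dot hG hH))

lemma integral_dot_sub {F G H : ℝ × ℝ → ℝ × ℝ} (hF : Continuous F) (hG : Continuous G)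
    (hH : Continuous H) (t : ι) : ∫ x in cell T t, dot (F x - G x) (H x)
      = (∫ x in cell T t, dot (F x) (H x)) - ∫ x in cell T t, dot (G x) (H x) := by
  simp only [dot_sub_left]
  exact integral_sub (integrableOn_cell T t (continuous_dot hF hH))
    (integrableOn_cell T t (continuous_dot hG hH))

lemma integral_dot_const_const (hT : Nondegenerate T) (t : ι) (a b : ℝ × ℝ) :
    ∫ _ in cell T t, dot a b = area T t * dot a b :=
  integral_cell_const T t (hT t) _

/-- Two Raviart-Thomas fields with the same mean divergences differ by a piecewise constant
field. -/
lemma exists_constField_sub_eq (hT : Nondegenerate T) {σ τ : ι → ℝ × ℝ → ℝ × ℝ}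
    (hσ : σ ∈ raviartThomas T) (hτ : τ ∈ raviartThomas T)
    (h : ∀ t, ∫ x in cell T t, div (σ t) x = ∫ x in cell T t, div (τ t) x) :
    ∃ a ∈ constFields T, ∀ t x, σ t x - τ t x = a t := by
  have key : ∀ t, ∃ a : ℝ × ℝ, ∀ x, σ t x - τ t x = a := by
    intro t
    obtain ⟨a, b, h1⟩ := hσ.1 t
    obtain ⟨a', b', h2⟩ := hτ.1 t
    have h3 := h t
    rw [integral_div_affine hT h1, integral_div_affine hT h2] at h3
    have h4 := mul_left_cancel₀ (hT.area_pos t).ne' h3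
    obtain rfl : b = b' := by linarith
    exact ⟨a - a', fun x => by rw [h1, h2]; abel⟩
  choose a ha using key
  refine ⟨a, ?_, ha⟩
  have h1 := sub_mem_raviartThomas hσ hτ
  have h2 : σ - τ = fun t _ => a t := by funext t x; exact ha t x
  rw [h2] at h1
  exact h1

/-! ### Solvability of the mixed system. -/

section Existence

variable [Fintype ι]

/-- The weighted Gram form is positive definite because all areas are positive; in finite dimension
an injective map to the dual is onto. -/
lemma exists_projection (hT : Nondegenerate T) (I : ι → ℝ × ℝ) :
    ∃ ν ∈ constFields T, ∀ a ∈ constFields T,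
      ∑ t, area T t * dot (ν t) (a t) = ∑ t, dot (I t) (a t) := by
  let N := constFields T
  let Φ : N →ₗ[ℝ] Module.Dual ℝ N := LinearMap.mk₂ ℝ
    (fun ν a => ∑ t, area T t * dot (ν.1 t) (a.1 t))
    (by intro a b c; simp [dot, ← Finset.sum_add_distrib]; congr 1; funext t; ring)
    (by intro r a b; simp [dot, Finset.mul_sum]; congr 1; funext t; ring)
    (by intro a b c; simp [dot, ← Finset.sum_add_distrib]; congr 1; funext t; ring)
    (by intro r a b; simp [dot, Finset.mul_sum]; congr 1; funext t; ring)
  have hΦ : ∀ ν a, Φ ν a = ∑ t, area T t * dot (ν.1 t) (a.1 t) := fun _ _ => rfl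
  have hinj : Function.Injective Φ := by
    rw [← LinearMap.ker_eq_bot, LinearMap.ker_eq_bot']
    intro ν hν
    have h0 : ∑ t, area T t * dot (ν.1 t) (ν.1 t) = 0 := by rw [← hΦ, hν]; rfl
    rw [Finset.sum_eq_zero_iff_of_nonneg
      (fun t _ => mul_nonneg (hT.area_pos t).le (dot_self_nonneg _))] at h0
    ext1
    funext t
    exact dot_self_eq_zero ((mul_eq_zero.1 (h0 t (Finset.mem_univ t))).resolve_left
      (hT.area_pos t).ne')
  have hsurj : Function.Surjective Φ :=
    (LinearMap.injective_iff_surjective_of_finrank_eq_finrank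
      (Subspace.dual_finrank_eq (K := ℝ) (V := N)).symm).1 hinj
  let ℓ : Module.Dual ℝ N :=
    { toFun := fun a => ∑ t, dot (I t) (a.1 t)
      map_add' := by intro a b; simp [dot, ← Finset.sum_add_distrib]; congr 1; funext t; ring
      map_smul' := by intro r a; simp [dot, Finset.mul_sum]; congr 1; funext t; ring }
  obtain ⟨ν, hν⟩ := hsurj ℓ
  refine ⟨ν.1, ν.2, fun a ha => ?_⟩
  rw [← hΦ ν ⟨a, ha⟩, hν]
  rfl

/-- Lagrange multipliers: the functional τ ↦ (σ, τ) vanishes on the common kernel of the cellwise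
divergences, which consists of piecewise constant fields. It is thus a linear combination of these
finitely many functionals, and the coefficients give -p. -/
lemma exists_pressure (hT : Nondegenerate T) {σ : ι → ℝ × ℝ → ℝ × ℝ} (hσ : ∀ t, Continuous (σ t))
    (horth : ∀ a ∈ constFields T, ∑ t, ∫ x in cell T t, dot (σ t x) (a t) = 0) :
    ∃ p : ι → ℝ, ∀ τ ∈ raviartThomas T,
      (∑ t, ∫ x in cell T t, dot (σ t x) (τ t x)) + ∑ t, ∫ x in cell T t, p t * div (τ t) x
        = 0 := by
  let V := raviartThomasSubmodule T
  let K : V →ₗ[ℝ] ℝ :=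
    { toFun := fun τ => ∑ t, ∫ x in cell T t, dot (τ.1 t x) (σ t x)
      map_add' := by
        intro τ τ'
        rw [← Finset.sum_add_distrib]
        exact Finset.sum_congr rfl fun t _ => integral_dot_add (continuous_of_mem τ.2 t)
          (continuous_of_mem τ'.2 t) (hσ t) t
      map_smul' := by
        intro r τ
        simp [dot_smul_left, integral_const_mul, Finset.mul_sum] }
  let D : ι → V →ₗ[ℝ] ℝ := fun t =>
    { toFun := fun τ => ∫ x in cell T t, div (τ.1 t) x
      map_add' := by
        intro τ τ'
        obtain ⟨a, b, h⟩ := τ.2.1 t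
        obtain ⟨a', b', h'⟩ := τ'.2.1 t
        rw [integral_div_affine hT h, integral_div_affine hT h', integral_div_affine hT
          (a := a + a') (b := b + b')
          (fun x => by simp only [Submodule.coe_add, Pi.add_apply, h, h', add_smul]; abel)]
        ring
      map_smul' := by
        intro r τ
        obtain ⟨a, b, h⟩ := τ.2.1 t
        rw [integral_div_affine hT h, integral_div_affine hT
          (a := r • a) (b := r * b)
          (fun x => by simp only [Submodule.coe_smul, Pi.smul_apply, h, smul_add, mul_smul])]
        simp
        ring }
  have hker : ⨅ t, LinearMap.ker (D t) ≤ LinearMap.ker K := by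
    intro τ hτ
    simp only [Submodule.mem_iInf, LinearMap.mem_ker] at hτ ⊢
    have hconst : ∀ t, ∃ a : ℝ × ℝ, ∀ x, τ.1 t x = a := by
      intro t
      obtain ⟨a, b, h⟩ := τ.2.1 t
      have h1 : area T t * (2 * b) = 0 := by rw [← integral_div_affine hT h]; exact hτ t
      obtain rfl : b = 0 := by
        have := (mul_eq_zero.1 h1).resolve_left (hT.area_pos t).ne'
        linarith
      exact ⟨a, fun x => by simp [h]⟩
    choose a ha using hconst
    have hmem : a ∈ constFields T := by
      have : τ.1 = fun t _ => a t := by funext t x; exact ha t x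
      have h2 := τ.2
      rw [this] at h2
      exact h2
    have := horth a hmem
    change ∑ t, ∫ x in cell T t, dot (τ.1 t x) (σ t x) = 0
    simpa only [ha, dot_comm] using this
  have hspan := mem_span_of_iInf_ker_le_ker hker
  rw [Submodule.mem_span_range_iff_exists_fun] at hspan
  obtain ⟨c, hc⟩ := hspan
  refine ⟨fun t => -c t, fun τ hτ => ?_⟩
  have h1 := LinearMap.congr_fun hc ⟨τ, hτ⟩
  simp only [LinearMap.coe_sum, Finset.sum_apply, LinearMap.smul_apply, smul_eq_mul] at h1
  change ∑ t, c t * ∫ x in cell T t, div (τ t) x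
    = ∑ t, ∫ x in cell T t, dot (τ t x) (σ t x) at h1
  simp only [dot_comm (σ _ _), ← h1, integral_const_mul]
  simp

lemma IsMixedSolution.integral_div {f : ℝ × ℝ → ℝ} {σ : ι → ℝ × ℝ → ℝ × ℝ} {p : ι → ℝ}
    (h : IsMixedSolution T f σ p) (t : ι) :
    ∫ x in cell T t, div (σ t) x = -∫ x in cell T t, f x := by
  classical
  have := h.2.2 (Pi.single t 1)
  simp only [integral_mul_const] at this
  rw [Finset.sum_eq_single t, Finset.sum_eq_single t] at this
  · simpa using this
  · intro s _ hs; simp [hs]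
  · simp
  · intro s _ hs; simp [hs]
  · simp

lemma IsMixedSolution.orthogonal {f : ℝ × ℝ → ℝ} {σ : ι → ℝ × ℝ → ℝ × ℝ} {p : ι → ℝ}
    (h : IsMixedSolution T f σ p) {a : ι → ℝ × ℝ} (ha : a ∈ constFields T) :
    ∑ t, ∫ x in cell T t, dot (σ t x) (a t) = 0 := by
  have h1 := h.2.1 _ ha
  have h2 : ∀ t x, div (fun _ : ℝ × ℝ => a t) x = 0 := by
    intro t x
    rw [div_affine (a := a t) (b := 0) (by simp)]
    simp
  simpa [h2] using h1

/-- The flux of the mixed method exists and is unique if the discrete divergence equation can be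
solved. -/
theorem exists_isMixedFlux (hT : Nondegenerate T) {f : ℝ × ℝ → ℝ} {τ : ι → ℝ × ℝ → ℝ × ℝ}
    (hτ : τ ∈ raviartThomas T)
    (hdiv : ∀ t, ∫ x in cell T t, div (τ t) x = -∫ x in cell T t, f x) :
    ∃ σ, IsMixedFlux T f σ := by
  obtain ⟨ν, hν, hproj⟩ := exists_projection hT
    (fun t => (∫ x in cell T t, (τ t x).1, ∫ x in cell T t, (τ t x).2))
  let σ : ι → ℝ × ℝ → ℝ × ℝ := τ - fun t _ => ν t
  have hσ : σ ∈ raviartThomas T := sub_mem_raviartThomas hτ hν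
  have horth : ∀ a ∈ constFields T, ∑ t, ∫ x in cell T t, dot (σ t x) (a t) = 0 := by
    intro a ha
    have h1 : ∀ t, ∫ x in cell T t, dot (σ t x) (a t)
        = dot (∫ x in cell T t, (τ t x).1, ∫ x in cell T t, (τ t x).2) (a t)
          - area T t * dot (ν t) (a t) := by
      intro t
      rw [← integral_dot_const (continuous_of_mem hτ t), ← integral_dot_const_const hT]
      exact integral_dot_sub (continuous_of_mem hτ t) continuous_const continuous_const t
    simp only [h1, Finset.sum_sub_distrib]
    rw [hproj a ha, sub_self]
  obtain ⟨p, hp⟩ := exists_pressure hT (continuous_of_mem hσ) horth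
  refine ⟨σ, p, hσ, hp, fun q => ?_⟩
  rw [← Finset.sum_neg_distrib]
  refine Finset.sum_congr rfl fun t _ => ?_
  rw [integral_mul_const, integral_mul_const, ← neg_mul, ← hdiv t]
  congr 1
  obtain ⟨a, b, h⟩ := hτ.1 t
  rw [integral_div_affine hT h, integral_div_affine hT (τ := σ) (a := a - ν t) (b := b)]
  intro x
  change τ t x - ν t = _
  rw [h]
  abel

/-- The difference of two fluxes is piecewise constant and orthogonal to all such fields in the
space, in particular to itself. -/
theorem IsMixedFlux.unique (hT : Nondegenerate T) {f : ℝ × ℝ → ℝ} {σ σ' : ι → ℝ × ℝ → ℝ × ℝ}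
    (hσ : IsMixedFlux T f σ) (hσ' : IsMixedFlux T f σ') : σ' = σ := by
  obtain ⟨p, hp⟩ := hσ
  obtain ⟨p', hp'⟩ := hσ'
  obtain ⟨a, ha, hsub⟩ := exists_constField_sub_eq hT hp'.1 hp.1
    (fun t => by rw [hp.integral_div, hp'.integral_div])
  have h1 : ∑ t, area T t * dot (a t) (a t) = 0 := by
    have h2 : ∀ t, area T t * dot (a t) (a t)
        = (∫ x in cell T t, dot (σ' t x) (a t)) - ∫ x in cell T t, dot (σ t x) (a t) := by
      intro t
      rw [← integral_dot_const_const hT, ← integral_dot_sub (continuous_of_mem hp'.1 t)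
        (continuous_of_mem hp.1 t) continuous_const]
      simp only [hsub]
    simp only [h2, Finset.sum_sub_distrib, hp.orthogonal ha, hp'.orthogonal ha, sub_self]
  rw [Finset.sum_eq_zero_iff_of_nonneg
      (fun t _ => mul_nonneg (hT.area_pos t).le (dot_self_nonneg _))] at h1
  funext t x
  have h3 : a t = 0 := dot_self_eq_zero ((mul_eq_zero.1 (h1 t (Finset.mem_univ t))).resolve_left
    (hT.area_pos t).ne')
  have h4 := hsub t x
  rw [h3] at h4
  exact sub_eq_zero.1 h4

end Existence

end Space

end RTMixed

namespace RTMixed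

/-! ### Geometry and combinatorics of the triangulations -/

section Mesh

variable {n m : ℕ}

/-- The horizontal mesh size `1 / (2n)`. -/
noncomputable def stepX (n : ℕ) : ℝ := 1 / (2 * n)

/-- The vertical mesh size `1 / (2m)`. -/
noncomputable def stepY (m : ℕ) : ℝ := 1 / (2 * m)

/-- The orientation `±1` of a triangle: whether its horizontal side is above or below its apex. -/
def dirY (t : TriIndex n m) : ℝ := ((t.1.2.2 : ℕ) : ℝ) - ((t.1.2.1 : ℕ) : ℝ)

/-- The horizontal distance from the left vertex to the apex. -/
noncomputable def legL (t : TriIndex n m) : ℝ := if (t.1.1 : ℕ) = 0 then 0 else stepX n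

/-- The horizontal distance from the apex to the right vertex. -/
noncomputable def legR (t : TriIndex n m) : ℝ := if (t.1.1 : ℕ) = 2 * n then 0 else stepX n

/-- The row of a triangle, counted from below. -/
def row (t : TriIndex n m) : ℕ := min (t.1.2.1 : ℕ) (t.1.2.2 : ℕ)

lemma stepX_pos (hn : 1 ≤ n) : 0 < stepX n := by
  have : (0 : ℝ) < n := by exact_mod_cast hn
  unfold stepX; positivity

lemma stepY_pos (hm : 1 ≤ m) : 0 < stepY m := stepX_pos hm

lemma stepX_mul (hn : 1 ≤ n) : 2 * (n : ℝ) * stepX n = 1 := by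
  have : (n : ℝ) ≠ 0 := by exact_mod_cast (by omega : n ≠ 0)
  unfold stepX; field_simp

lemma stepY_mul (hm : 1 ≤ m) : 2 * (m : ℝ) * stepY m = 1 := stepX_mul hm

lemma stepX_le_half (hn : 1 ≤ n) : stepX n ≤ 1 / 2 := by
  have h1 : (1 : ℝ) ≤ n := by exact_mod_cast hn
  nlinarith [stepX_mul hn, stepX_pos hn]

lemma stepY_le_stepX (hn : 1 ≤ n) (hnm : n ≤ m) : stepY m ≤ stepX n := by
  have h1 : (1 : ℝ) ≤ n := by exact_mod_cast hn
  have h2 : (n : ℝ) ≤ m := by exact_mod_cast hnm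
  unfold stepX stepY
  gcongr

lemma fst_le (t : TriIndex n m) : (t.1.1 : ℕ) ≤ 2 * n := Nat.lt_succ_iff.1 t.1.1.2

lemma apex_le (t : TriIndex n m) : (t.1.2.1 : ℕ) ≤ 2 * m := Nat.lt_succ_iff.1 t.1.2.1.2

lemma side_le (t : TriIndex n m) : (t.1.2.2 : ℕ) ≤ 2 * m := Nat.lt_succ_iff.1 t.1.2.2.2

lemma dirY_eq (t : TriIndex n m) : dirY t = 1 ∨ dirY t = -1 := by
  unfold dirY
  rcases t.2.2 with h | h
  · left; rw [h]; push_cast; ring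
  · right; rw [h]; push_cast; ring

lemma dirY_sq (t : TriIndex n m) : dirY t ^ 2 = 1 := by
  rcases dirY_eq t with h | h <;> rw [h] <;> norm_num

lemma abs_dirY (t : TriIndex n m) : |dirY t| = 1 := by
  rcases dirY_eq t with h | h <;> rw [h] <;> norm_num

lemma legL_nonneg (t : TriIndex n m) : 0 ≤ legL t := by
  unfold legL stepX; split_ifs <;> positivity

lemma legR_nonneg (t : TriIndex n m) : 0 ≤ legR t := by
  unfold legR stepX; split_ifs <;> positivity

lemma legL_le (t : TriIndex n m) : legL t ≤ stepX n := by
  unfold legL stepX; split_ifs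
  · positivity
  · exact le_rfl

lemma legR_le (t : TriIndex n m) : legR t ≤ stepX n := by
  unfold legR stepX; split_ifs
  · positivity
  · exact le_rfl

lemma stepX_le_leg_add (hn : 1 ≤ n) (t : TriIndex n m) : stepX n ≤ legL t + legR t := by
  have := stepX_pos hn
  unfold legL legR
  split_ifs <;> first | omega | linarith

lemma vertex_zero (t : TriIndex n m) : triangulation n m t 0
    = ((t.1.1 : ℕ) * stepX n, (t.1.2.1 : ℕ) * stepY m) := by
  simp [triangulation, gridPoint, stepX, stepY, div_eq_mul_inv]

lemma vertex_one (t : TriIndex n m) : triangulation n m t 1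
    = ((t.1.1 : ℕ) * stepX n - legL t, (t.1.2.1 : ℕ) * stepY m + dirY t * stepY m) := by
  have h1 : triangulation n m t 1 = gridPoint n m ((t.1.1 : ℕ) - 1) t.1.2.2 := rfl
  rw [h1, gridPoint, dirY, legL]
  ext
  · simp only [stepX]
    split_ifs with h
    · simp [h]
    · rw [Nat.cast_sub (by omega)]; push_cast; ring
  · simp only [stepY]; ring

lemma vertex_two (t : TriIndex n m) : triangulation n m t 2
    = ((t.1.1 : ℕ) * stepX n + legR t, (t.1.2.1 : ℕ) * stepY m + dirY t * stepY m) := by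
  have h1 : triangulation n m t 2 = gridPoint n m (min ((t.1.1 : ℕ) + 1) (2 * n)) t.1.2.2 := rfl
  have h2 := fst_le t
  rw [h1, gridPoint, dirY, legR]
  ext
  · simp only [stepX]
    split_ifs with h
    · rw [min_eq_right (by omega), h]; push_cast; ring
    · rw [min_eq_left (by omega)]; push_cast; ring
  · simp only [stepY]; ring

lemma orient_triangulation (t : TriIndex n m) :
    orient (triangulation n m t 0) (triangulation n m t 1) (triangulation n m t 2)
      = -dirY t * (stepY m * (legL t + legR t)) := by
  simp only [vertex_zero, vertex_one, vertex_two, orient]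
  ring

lemma leg_add_pos (hn : 1 ≤ n) (t : TriIndex n m) : 0 < legL t + legR t :=
  (stepX_pos hn).trans_le (stepX_le_leg_add hn t)

lemma nondegenerate_triangulation (hn : 1 ≤ n) (hm : 1 ≤ m) :
    Nondegenerate (triangulation n m) := by
  intro t
  rw [orient_triangulation]
  have h1 := stepY_pos hm
  have h2 := leg_add_pos hn t
  rcases dirY_eq t with h | h <;> rw [h]
  · have := mul_pos h1 h2; linarith
  · have := mul_pos h1 h2; linarith

lemma area_triangulation (hn : 1 ≤ n) (hm : 1 ≤ m) (t : TriIndex n m) :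
    area (triangulation n m) t = stepY m * (legL t + legR t) / 2 := by
  rw [area, orient_triangulation, abs_mul, abs_neg, abs_dirY, one_mul,
    abs_of_pos (mul_pos (stepY_pos hm) (leg_add_pos hn t))]

lemma area_le (hn : 1 ≤ n) (hm : 1 ≤ m) (t : TriIndex n m) :
    area (triangulation n m) t ≤ stepX n * stepY m := by
  rw [area_triangulation hn hm]
  nlinarith [stepY_pos hm, legL_le t, legR_le t]

lemma apexX_mem (hn : 1 ≤ n) (t : TriIndex n m) :
    0 ≤ (t.1.1 : ℕ) * stepX n - legL t ∧ (t.1.1 : ℕ) * stepX n + legR t ≤ 1 := by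
  have h0 := stepX_pos hn
  have h1 := stepX_mul hn
  have h2 := fst_le t
  constructor
  · unfold legL
    split_ifs with h
    · simp [h]
    · have : (1 : ℝ) ≤ (t.1.1 : ℕ) := by exact_mod_cast Nat.one_le_iff_ne_zero.2 h
      nlinarith
  · unfold legR
    split_ifs with h
    · rw [h]; push_cast; linarith
    · have : ((t.1.1 : ℕ) : ℝ) + 1 ≤ 2 * n := by exact_mod_cast (by omega : (t.1.1 : ℕ) + 1 ≤ 2 * n)
      nlinarith

lemma row_cases (t : TriIndex n m) :
    (dirY t = 1 ∧ (t.1.2.1 : ℕ) = row t) ∨ (dirY t = -1 ∧ (t.1.2.1 : ℕ) = row t + 1) := by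
  unfold dirY row
  rcases t.2.2 with h | h
  · left
    refine ⟨by rw [h]; push_cast; ring, by omega⟩
  · right
    refine ⟨by rw [h]; push_cast; ring, by omega⟩

lemma row_lt (t : TriIndex n m) : row t < 2 * m := by
  unfold row
  have h1 := apex_le t
  have h2 := side_le t
  rcases t.2.2 with h | h <;> omega

/-- A triangle lies in its row and between its left and its right vertex. -/
lemma cell_subset (t : TriIndex n m) : cell (triangulation n m) t ⊆
    Set.Icc ((t.1.1 : ℕ) * stepX n - legL t, row t * stepY m)
      ((t.1.1 : ℕ) * stepX n + legR t, (row t + 1) * stepY m) := by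
  have hY : 0 ≤ stepY m := by unfold stepY; positivity
  have h1 := legL_nonneg t
  have h2 := legR_nonneg t
  refine convexHull_min ?_ (convex_Icc _ _)
  rintro _ ⟨i, rfl⟩
  rcases row_cases t with ⟨hs, hj⟩ | ⟨hs, hj⟩ <;> fin_cases i <;>
    simp only [Fin.zero_eta, Fin.mk_one, Fin.reduceFinMk, vertex_zero, vertex_one, vertex_two, hs,
      hj, Set.mem_Icc, Prod.mk_le_mk] <;> push_cast <;>
    refine ⟨⟨?_, ?_⟩, ?_, ?_⟩ <;> linarith

lemma cell_mem_unitSquare (hn : 1 ≤ n) (hm : 1 ≤ m) {t : TriIndex n m} {x : ℝ × ℝ}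
    (hx : x ∈ cell (triangulation n m) t) : (0 ≤ x.1 ∧ x.1 ≤ 1) ∧ 0 ≤ x.2 ∧ x.2 ≤ 1 := by
  have h := cell_subset t hx
  have h1 := apexX_mem hn t
  have h2 := stepY_mul hm
  have h3 := stepY_pos hm
  have h4 : ((row t : ℕ) : ℝ) + 1 ≤ 2 * m := by exact_mod_cast row_lt t
  have h5 : (0 : ℝ) ≤ row t := Nat.cast_nonneg _
  obtain ⟨⟨ha, hb⟩, hc, hd⟩ := h
  simp only at ha hb hc hd
  refine ⟨⟨by linarith, by linarith⟩, by nlinarith, by nlinarith⟩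

lemma vertex_mem_cell (t : TriIndex n m) (i : Fin 3) :
    triangulation n m t i ∈ cell (triangulation n m) t :=
  subset_convexHull ℝ _ ⟨i, rfl⟩

lemma half_add_mem_cell (t : TriIndex n m) (i j : Fin 3) :
    (1 / 2 : ℝ) • (triangulation n m t i + triangulation n m t j)
      ∈ cell (triangulation n m) t := by
  rw [smul_add]
  exact convex_convexHull ℝ _ (vertex_mem_cell t i) (vertex_mem_cell t j) (by norm_num)
    (by norm_num) (by norm_num)

lemma abs_sub_le_of_mem_cell {t : TriIndex n m} {x y : ℝ × ℝ}
    (hx : x ∈ cell (triangulation n m) t) (hy : y ∈ cell (triangulation n m) t) :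
    |x.1 - y.1| ≤ 2 * stepX n ∧ |x.2 - y.2| ≤ stepY m := by
  obtain ⟨⟨ha, hb⟩, hc, hd⟩ := cell_subset t hx
  obtain ⟨⟨ha', hb'⟩, hc', hd'⟩ := cell_subset t hy
  simp only at ha hb hc hd ha' hb' hc' hd'
  have h1 := legL_le t
  have h2 := legR_le t
  refine ⟨abs_le.2 ⟨?_, ?_⟩, abs_le.2 ⟨?_, ?_⟩⟩ <;> linarith

lemma abs_sub_apex_le {t : TriIndex n m} {x : ℝ × ℝ} (hx : x ∈ cell (triangulation n m) t) :
    |x.1 - (triangulation n m t 0).1| ≤ stepX n ∧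
      |x.2 - (triangulation n m t 0).2| ≤ stepY m := by
  refine ⟨?_, (abs_sub_le_of_mem_cell hx (vertex_mem_cell t 0)).2⟩
  obtain ⟨⟨ha, -⟩, ⟨hb, -⟩⟩ := cell_subset t hx
  simp only [vertex_zero] at *
  have h1 := legL_le t
  have h2 := legR_le t
  exact abs_le.2 ⟨by linarith, by linarith⟩

/-- The neighbour across the right side; the last triangle of a row is followed by the first. -/
def rightNbrFun (t : TriIndex n m) : TriIndex n m :=
  if h : (t.1.1 : ℕ) < 2 * n then
    ⟨(⟨t.1.1 + 1, by omega⟩, t.1.2.2, t.1.2.1), by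
      have h1 := t.2.1
      have h2 := t.2.2
      simp only
      omega⟩
  else
    ⟨(⟨0, by omega⟩, t.1.2.1, t.1.2.2), by
      have h1 := t.2.1
      have h2 := t.2.2
      have h3 := fst_le t
      simp only
      omega⟩

lemma rightNbrFun_injective : Function.Injective (rightNbrFun (n := n) (m := m)) := by
  rintro ⟨⟨i, j, k⟩, h⟩ ⟨⟨i', j', k'⟩, h'⟩ heq
  have h1 := i.2
  have h2 := i'.2
  simp only [rightNbrFun] at heq
  split_ifs at heq with c c' <;>
    simp only [Subtype.mk.injEq, Prod.mk.injEq, Fin.ext_iff] at heq c h h' ⊢ <;> omega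

/-- The neighbour across the right side, as a permutation of the triangles. -/
noncomputable def rightNbr : Equiv.Perm (TriIndex n m) :=
  Equiv.ofBijective rightNbrFun (Finite.injective_iff_bijective.1 rightNbrFun_injective)

lemma rightNbr_of_lt {t : TriIndex n m} (h : (t.1.1 : ℕ) < 2 * n) :
    ((rightNbr t).1.1 : ℕ) = t.1.1 + 1 ∧ (rightNbr t).1.2.1 = t.1.2.2 ∧
      (rightNbr t).1.2.2 = t.1.2.1 := by
  have : rightNbr t = rightNbrFun t := rfl
  rw [this, rightNbrFun, dif_pos h]
  exact ⟨rfl, rfl, rfl⟩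

lemma rightNbr_of_eq {t : TriIndex n m} (h : (t.1.1 : ℕ) = 2 * n) :
    ((rightNbr t).1.1 : ℕ) = 0 ∧ (rightNbr t).1.2.1 = t.1.2.1 ∧
      (rightNbr t).1.2.2 = t.1.2.2 := by
  have : rightNbr t = rightNbrFun t := rfl
  rw [this, rightNbrFun, dif_neg (by omega)]
  exact ⟨rfl, rfl, rfl⟩

lemma lt_or_eq (t : TriIndex n m) : (t.1.1 : ℕ) < 2 * n ∨ (t.1.1 : ℕ) = 2 * n :=
  (fst_le t).lt_or_eq

lemma legR_of_eq {t : TriIndex n m} (h : (t.1.1 : ℕ) = 2 * n) : legR t = 0 := if_pos h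

lemma legL_rightNbr (t : TriIndex n m) : legL (rightNbr t) = legR t := by
  rcases lt_or_eq t with h | h
  · rw [legL, legR, (rightNbr_of_lt h).1, if_neg (by omega), if_neg (by omega)]
  · rw [legL, legR, (rightNbr_of_eq h).1, if_pos rfl, if_pos h]

lemma row_rightNbr (t : TriIndex n m) : row (rightNbr t) = row t := by
  rcases lt_or_eq t with h | h
  · rw [row, row, (rightNbr_of_lt h).2.1, (rightNbr_of_lt h).2.2, min_comm]
  · rw [row, row, (rightNbr_of_eq h).2.1, (rightNbr_of_eq h).2.2]

lemma dirY_rightNbr {t : TriIndex n m} (h : (t.1.1 : ℕ) < 2 * n) :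
    dirY (rightNbr t) = -dirY t := by
  rw [dirY, dirY, (rightNbr_of_lt h).2.1, (rightNbr_of_lt h).2.2]; ring

lemma vertex_rightNbr {t : TriIndex n m} (h : (t.1.1 : ℕ) < 2 * n) :
    triangulation n m (rightNbr t) 0 = triangulation n m t 2 ∧
      triangulation n m (rightNbr t) 1 = triangulation n m t 0 := by
  obtain ⟨h1, h2, h3⟩ := rightNbr_of_lt h
  constructor
  · change gridPoint n m _ _ = gridPoint n m _ _
    rw [h1, h2, min_eq_left (by omega)]
  · change gridPoint n m _ _ = gridPoint n m _ _
    rw [h1, h3, Nat.add_sub_cancel]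

/-- The neighbour across the horizontal side; a triangle with its horizontal side on the boundary
is its own neighbour. -/
def horizNbrFun (t : TriIndex n m) : TriIndex n m :=
  if h : (t.1.2.2 : ℕ) = 0 ∨ (t.1.2.2 : ℕ) = 2 * m then t
  else ⟨(t.1.1, ⟨2 * t.1.2.2 - t.1.2.1, by
      have h2 := t.2.2
      have h3 := side_le t
      omega⟩, t.1.2.2), by
      have h1 := t.2.1
      have h2 := t.2.2
      simp only
      omega⟩

lemma horizNbrFun_of_interior {t : TriIndex n m}
    (h : ¬((t.1.2.2 : ℕ) = 0 ∨ (t.1.2.2 : ℕ) = 2 * m)) :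
    (horizNbrFun t).1.1 = t.1.1 ∧ ((horizNbrFun t).1.2.1 : ℕ) = 2 * t.1.2.2 - t.1.2.1 ∧
      (horizNbrFun t).1.2.2 = t.1.2.2 := by
  rw [horizNbrFun, dif_neg h]
  exact ⟨rfl, rfl, rfl⟩

lemma horizNbrFun_involutive : Function.Involutive (horizNbrFun (n := n) (m := m)) := by
  intro t
  by_cases h : (t.1.2.2 : ℕ) = 0 ∨ (t.1.2.2 : ℕ) = 2 * m
  · have : horizNbrFun t = t := dif_pos h
    rw [this, this]
  · obtain ⟨h1, h2, h3⟩ := horizNbrFun_of_interior h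
    obtain ⟨h1', h2', h3'⟩ := horizNbrFun_of_interior (t := horizNbrFun t) (by rw [h3]; exact h)
    rw [h1] at h1'
    rw [h2, h3] at h2'
    rw [h3] at h3'
    have h4 := t.2.2
    ext
    · rw [h1']
    · rw [h2']; omega
    · rw [h3']

/-- The neighbour across the horizontal side, as a permutation of the triangles. -/
def horizNbr : Equiv.Perm (TriIndex n m) := horizNbrFun_involutive.toPerm

lemma horizNbr_of_boundary {t : TriIndex n m}
    (h : (t.1.2.2 : ℕ) = 0 ∨ (t.1.2.2 : ℕ) = 2 * m) : horizNbr t = t := dif_pos h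

lemma dirY_horizNbr {t : TriIndex n m}
    (h : ¬((t.1.2.2 : ℕ) = 0 ∨ (t.1.2.2 : ℕ) = 2 * m)) : dirY (horizNbr t) = -dirY t := by
  obtain ⟨-, h2, h3⟩ := horizNbrFun_of_interior h
  have : horizNbr t = horizNbrFun t := rfl
  have h4 := t.2.2
  rw [dirY, dirY, this, h2, h3, Nat.cast_sub (by omega)]
  push_cast
  ring

lemma vertex_horizNbr {t : TriIndex n m}
    (h : ¬((t.1.2.2 : ℕ) = 0 ∨ (t.1.2.2 : ℕ) = 2 * m)) :
    triangulation n m (horizNbr t) 1 = triangulation n m t 1 ∧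
      triangulation n m (horizNbr t) 2 = triangulation n m t 2 := by
  obtain ⟨h1, -, h3⟩ := horizNbrFun_of_interior h
  have : horizNbr t = horizNbrFun t := rfl
  constructor
  · change gridPoint n m _ _ = gridPoint n m _ _
    rw [this, h1, h3]
  · change gridPoint n m _ _ = gridPoint n m _ _
    rw [this, h1, h3]

/-- A triangle is determined by its column and its row. -/
def triEquiv (n m : ℕ) : TriIndex n m ≃ Fin (2 * n + 1) × Fin (2 * m) where
  toFun t := (t.1.1, ⟨row t, row_lt t⟩)
  invFun p := if h : ((p.1 : ℕ) + p.2) % 2 = 0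
    then ⟨(p.1, ⟨p.2, by omega⟩, ⟨p.2 + 1, by omega⟩),
      (by change (p.1 : ℕ) % 2 = (p.2 : ℕ) % 2; omega), Or.inl rfl⟩
    else ⟨(p.1, ⟨p.2 + 1, by omega⟩, ⟨p.2, by omega⟩),
      (by change (p.1 : ℕ) % 2 = ((p.2 : ℕ) + 1) % 2; omega), Or.inr rfl⟩
  left_inv t := by
    have h1 := t.2.1
    have h2 := t.2.2
    dsimp only
    split_ifs with h <;> simp only [row] at h <;> ext <;> simp only [row] <;> omega
  right_inv p := by
    dsimp only
    split_ifs with h <;> ext <;> simp only [row] <;> omega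

/-- Each column contains exactly one triangle in each row, so sums of products of column and row
terms factor. -/
lemma sum_triIndex (F : ℕ → ℕ → ℝ) : ∑ t : TriIndex n m, F t.1.1 (row t)
    = ∑ i ∈ Finset.range (2 * n + 1), ∑ j ∈ Finset.range (2 * m), F i j := by
  rw [Finset.sum_range, ← (triEquiv n m).symm.sum_comp, Fintype.sum_prod_type]
  refine Finset.sum_congr rfl fun i _ => ?_
  rw [Finset.sum_range]
  refine Finset.sum_congr rfl fun j _ => ?_
  have h := (triEquiv n m).apply_symm_apply (i, j)
  have h1 := congrArg (fun p => (p.1 : ℕ)) h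
  have h2 := congrArg (fun p => (p.2 : ℕ)) h
  change (((triEquiv n m).symm (i, j)).1.1 : ℕ) = i at h1
  change row ((triEquiv n m).symm (i, j)) = j at h2
  rw [h1, h2]

lemma sum_triIndex_const (c : ℝ) :
    ∑ _t : TriIndex n m, c = (2 * n + 1) * (2 * m) * c := by
  rw [sum_triIndex (fun _ _ => c)]
  simp
  ring

/-- The half triangles at the two vertical sides are counted as full ones; the excess is X ≤ 1/2. -/
lemma sum_area_le (hn : 1 ≤ n) (hm : 1 ≤ m) :
    ∑ t, area (triangulation n m) t ≤ 3 / 2 := by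
  refine (Finset.sum_le_sum fun t _ => area_le hn hm t).trans ?_
  rw [sum_triIndex_const]
  have h1 := stepX_mul hn
  have h2 := stepY_mul hm
  have h3 := stepX_le_half hn
  calc (2 * (n : ℝ) + 1) * (2 * m) * (stepX n * stepY m)
      = (2 * n * stepX n + stepX n) * (2 * m * stepY m) := by ring
    _ ≤ 3 / 2 := by rw [h1, h2]; linarith

/-- Integrands that are uniformly bounded have a bounded sum of integrals. -/
lemma sum_integral_le (hn : 1 ≤ n) (hm : 1 ≤ m) {g : TriIndex n m → ℝ × ℝ → ℝ} {M : ℝ}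
    (hM : 0 ≤ M) (hg : ∀ t, ∀ x ∈ cell (triangulation n m) t, |g t x| ≤ M) :
    |∑ t, ∫ x in cell (triangulation n m) t, g t x| ≤ 3 / 2 * M := by
  refine (Finset.abs_sum_le_sum_abs _ _).trans ?_
  refine (Finset.sum_le_sum fun t _ => abs_integral_cell_le _ t
    (nondegenerate_triangulation hn hm t) (hg t)).trans ?_
  rw [← Finset.sum_mul]
  exact mul_le_mul_of_nonneg_right (sum_area_le hn hm) hM

/-! ### Fluxes and gradients of nonconforming elements -/

/-- The flux out of the triangle through its right side, by the midpoint rule. -/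
noncomputable def fluxR (τ : TriIndex n m → ℝ × ℝ → ℝ × ℝ) (t : TriIndex n m) : ℝ :=
  dirY t * dot (τ t ((1 / 2 : ℝ) • (triangulation n m t 2 + triangulation n m t 0)))
    (normal (triangulation n m t 2) (triangulation n m t 0))

/-- The flux out of the triangle through its left side, by the midpoint rule. -/
noncomputable def fluxL (τ : TriIndex n m → ℝ × ℝ → ℝ × ℝ) (t : TriIndex n m) : ℝ :=
  dirY t * dot (τ t ((1 / 2 : ℝ) • (triangulation n m t 0 + triangulation n m t 1)))
    (normal (triangulation n m t 0) (triangulation n m t 1))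

/-- The flux out of the triangle through its horizontal side, by the midpoint rule. -/
noncomputable def fluxH (τ : TriIndex n m → ℝ × ℝ → ℝ × ℝ) (t : TriIndex n m) : ℝ :=
  dirY t * dot (τ t ((1 / 2 : ℝ) • (triangulation n m t 1 + triangulation n m t 2)))
    (normal (triangulation n m t 1) (triangulation n m t 2))

lemma half_add_mem_segment (p q : ℝ × ℝ) : (1 / 2 : ℝ) • (p + q) ∈ segment ℝ p q := by
  rw [smul_add]
  exact ⟨1 / 2, 1 / 2, by norm_num, by norm_num, by norm_num, rfl⟩

lemma fluxR_add_fluxL {τ : TriIndex n m → ℝ × ℝ → ℝ × ℝ}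
    (hτ : τ ∈ raviartThomas (triangulation n m)) {t : TriIndex n m} (h : (t.1.1 : ℕ) < 2 * n) :
    fluxR τ t + fluxL τ (rightNbr t) = 0 := by
  obtain ⟨h0, h1⟩ := vertex_rightNbr h
  have := hτ.2 t (rightNbr t) (triangulation n m t 2) ⟨⟨2, rfl⟩, ⟨0, h0⟩⟩
    (triangulation n m t 0) ⟨⟨0, rfl⟩, ⟨1, h1⟩⟩ _ (half_add_mem_segment _ _)
  rw [fluxR, fluxL, dirY_rightNbr h, h0, h1, normal, this]
  ring

lemma fluxH_add_fluxH {τ : TriIndex n m → ℝ × ℝ → ℝ × ℝ}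
    (hτ : τ ∈ raviartThomas (triangulation n m)) {t : TriIndex n m}
    (h : ¬((t.1.2.2 : ℕ) = 0 ∨ (t.1.2.2 : ℕ) = 2 * m)) :
    fluxH τ t + fluxH τ (horizNbr t) = 0 := by
  obtain ⟨h0, h1⟩ := vertex_horizNbr h
  have := hτ.2 t (horizNbr t) (triangulation n m t 1) ⟨⟨1, rfl⟩, ⟨1, h0⟩⟩
    (triangulation n m t 2) ⟨⟨2, rfl⟩, ⟨2, h1⟩⟩ _ (half_add_mem_segment _ _)
  rw [fluxH, fluxH, dirY_horizNbr h, h0, h1, normal, this]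
  ring

/-- The gradient of the affine function with given values at the midpoints of the right, the left
and the horizontal side. -/
noncomputable def crGrad (t : TriIndex n m) (vR vL vH : ℝ) : ℝ × ℝ :=
  (2 * (vR - vL) / (legL t + legR t),
    -2 * dirY t * (legR t * (vR - vH) + legL t * (vL - vH)) / (stepY m * (legL t + legR t)))

/-- Integration by parts of a Raviart-Thomas field against an affine function. -/
lemma integral_dot_crGrad (hn : 1 ≤ n) (hm : 1 ≤ m) {τ : TriIndex n m → ℝ × ℝ → ℝ × ℝ}
    (hτ : τ ∈ raviartThomas (triangulation n m)) (t : TriIndex n m) (vR vL vH : ℝ) :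
    ∫ x in cell (triangulation n m) t, dot (τ t x) (crGrad t vR vL vH)
      = vR * fluxR τ t + vL * fluxL τ t + vH * fluxH τ t
        - (vR + vL + vH) / 3 * ∫ x in cell (triangulation n m) t, div (τ t) x := by
  have hT := nondegenerate_triangulation hn hm
  obtain ⟨a, β, h⟩ := hτ.1 t
  have h1 := (leg_add_pos hn t).ne'
  have h2 := (stepY_pos hm).ne'
  have h3 := dirY_sq t
  -- The integrand is affine, so the midpoint rule is exact. On the boundary, normal components are
  -- constant along sides, so only the midpoint values of the affine function enter.
  rw [integral_div_affine hT h, integral_cell_quadratic _ t (hT t)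
    (dot a (crGrad t vR vL vH)) (β * (crGrad t vR vL vH).1) (β * (crGrad t vR vL vH).2) 0 0 0
    (by intro x; rw [h]; simp [dot]; ring)]
  simp only [area_triangulation hn hm, fluxR, fluxL, fluxH, mid, h, crGrad, normal, dot,
    vertex_zero, vertex_one, vertex_two]
  simp
  rcases dirY_eq t with hs | hs <;> rw [hs] <;> field_simp <;> ring

end Mesh

end RTMixed

namespace RTMixed

/-! ### The upper bound -/

section Upper

/-- The gradient of `modelU`. -/
def gradU (x : ℝ × ℝ) : ℝ × ℝ :=
  ((1 - 2 * x.1) * (x.2 * (1 - x.2)), x.1 * (1 - x.1) * (1 - 2 * x.2))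

lemma grad_modelU : grad modelU = gradU := by
  funext x
  have h1 : HasFDerivAt (fun x : ℝ × ℝ => x.1) (ContinuousLinearMap.fst ℝ ℝ ℝ) x := hasFDerivAt_fst
  have h2 : HasFDerivAt (fun x : ℝ × ℝ => x.2) (ContinuousLinearMap.snd ℝ ℝ ℝ) x := hasFDerivAt_snd
  have h : HasFDerivAt modelU _ x := ((h1.mul (h1.const_sub 1)).mul h2).mul (h2.const_sub 1)
  simp only [grad, h.fderiv, gradU]
  ext <;> simp <;> ring

lemma continuous_gradU : Continuous gradU := by unfold gradU; fun_prop

/-- A field with divergence `-modelF` and without vertical component. -/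
noncomputable def horizField (x : ℝ × ℝ) : ℝ × ℝ :=
  (-2 * (x.1 ^ 2 / 2 - x.1 ^ 3 / 3 + x.1 * (x.2 * (1 - x.2))), 0)

/-- The divergence theorem in exact form: the field is cubic and Simpson's rule is exact for cubics,
while the midpoint rule is exact for the quadratic right-hand side. -/
lemma edgeFlux_gradU (A B C : ℝ × ℝ) :
    edgeFlux gradU A B + edgeFlux gradU B C + edgeFlux gradU C A
      = orient A B C / 6 * (modelF ((1 / 2 : ℝ) • (B + C)) + modelF ((1 / 2 : ℝ) • (C + A))
        + modelF ((1 / 2 : ℝ) • (A + B))) := by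
  simp [edgeFlux, dot, normal, orient, modelF, gradU]
  ring

lemma edgeFlux_horizField (A B C : ℝ × ℝ) :
    edgeFlux horizField A B + edgeFlux horizField B C + edgeFlux horizField C A
      = orient A B C / 6 * (modelF ((1 / 2 : ℝ) • (B + C)) + modelF ((1 / 2 : ℝ) • (C + A))
        + modelF ((1 / 2 : ℝ) • (A + B))) := by
  simp [edgeFlux, dot, normal, orient, modelF, horizField]
  ring

lemma integral_modelF {ι : Type*} {T : ι → Fin 3 → ℝ × ℝ} (hT : Nondegenerate T) (t : ι) :
    ∫ x in cell T t, modelF x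
      = area T t / 3 * (modelF (mid T t 0) + modelF (mid T t 1) + modelF (mid T t 2)) :=
  integral_cell_quadratic T t (hT t) 0 2 2 (-2) 0 (-2) (fun x => by simp only [modelF]; ring)

/-- The Raviart-Thomas interpolant of a field, with fluxes evaluated by Simpson's rule. -/
noncomputable def interpolant {ι : Type*} (T : ι → Fin 3 → ℝ × ℝ) (ψ : ℝ × ℝ → ℝ × ℝ) :
    ι → ℝ × ℝ → ℝ × ℝ := fun t => rtInterp (edgeFlux ψ) (T t 0) (T t 1) (T t 2)

lemma interpolant_mem {ι : Type*} {T : ι → Fin 3 → ℝ × ℝ} (hT : Nondegenerate T)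
    (ψ : ℝ × ℝ → ℝ × ℝ) : interpolant T ψ ∈ raviartThomas T :=
  rtInterp_mem_raviartThomas (edgeFlux_swap ψ) hT

lemma integral_div_interpolant {ι : Type*} {T : ι → Fin 3 → ℝ × ℝ} (hT : Nondegenerate T)
    {ψ : ℝ × ℝ → ℝ × ℝ} (hψ : ∀ A B C, edgeFlux ψ A B + edgeFlux ψ B C + edgeFlux ψ C A
      = orient A B C / 6 * (modelF ((1 / 2 : ℝ) • (B + C)) + modelF ((1 / 2 : ℝ) • (C + A))
        + modelF ((1 / 2 : ℝ) • (A + B)))) (t : ι) :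
    ∫ x in cell T t, div (interpolant T ψ t) x = -∫ x in cell T t, modelF x := by
  have hD := hT t
  rw [integral_div_affine hT (rtInterp_eq _ _ _ _), integral_modelF hT, hψ]
  simp only [mid, Matrix.cons_val_zero, Matrix.cons_val_one, Matrix.cons_val]
  field_simp
  ring

variable {n m : ℕ}

/-- Twice the area is at least XY, and a triangle has width at most 2X and height at most Y. The
horizontal component thus loses a factor 1/Y and the vertical one only 1/X. -/
lemma abs_rtInterp_le (hn : 1 ≤ n) (hm : 1 ≤ m) {F : ℝ × ℝ → ℝ × ℝ → ℝ} {M : ℝ}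
    {t : TriIndex n m} {x : ℝ × ℝ} (hx : x ∈ cell (triangulation n m) t)
    (h0 : |F (triangulation n m t 0) (triangulation n m t 1)| ≤ M)
    (h1 : |F (triangulation n m t 1) (triangulation n m t 2)| ≤ M)
    (h2 : |F (triangulation n m t 2) (triangulation n m t 0)| ≤ M) :
    |(rtInterp F (triangulation n m t 0) (triangulation n m t 1) (triangulation n m t 2) x).1|
        ≤ 6 * M / stepY m ∧
    |(rtInterp F (triangulation n m t 0) (triangulation n m t 1) (triangulation n m t 2) x).2|
        ≤ 3 * M / stepX n := by
  have hX := stepX_pos hn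
  have hY := stepY_pos hm
  have hM : 0 ≤ M := (abs_nonneg _).trans h0
  have hD : |-(1 / orient (triangulation n m t 0) (triangulation n m t 1) (triangulation n m t 2))|
      ≤ 1 / (stepY m * stepX n) := by
    rw [orient_triangulation, abs_neg, abs_div, abs_one, abs_mul, abs_neg, abs_dirY, one_mul,
      abs_of_pos (mul_pos hY (leg_add_pos hn t))]
    have := stepX_le_leg_add hn t
    gcongr
  have key : ∀ f g k a b c r : ℝ, |f| ≤ M → |g| ≤ M → |k| ≤ M → |a| ≤ r → |b| ≤ r → |c| ≤ r →
      |f * a + g * b + k * c| ≤ 3 * M * r := by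
    intro f g k a b c r hf hg hk ha hb hc
    have hr : 0 ≤ r := (abs_nonneg _).trans ha
    calc |f * a + g * b + k * c| ≤ |f * a| + |g * b| + |k * c| := abs_add_three _ _ _
      _ ≤ M * r + M * r + M * r := by
        rw [abs_mul, abs_mul, abs_mul]; gcongr
      _ = 3 * M * r := by ring
  obtain ⟨p0, q0⟩ := abs_sub_le_of_mem_cell hx (vertex_mem_cell t 0)
  obtain ⟨p1, q1⟩ := abs_sub_le_of_mem_cell hx (vertex_mem_cell t 1)
  obtain ⟨p2, q2⟩ := abs_sub_le_of_mem_cell hx (vertex_mem_cell t 2)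
  constructor
  · simp only [rtInterp, Prod.smul_fst, Prod.fst_add, Prod.fst_sub, smul_eq_mul, abs_mul]
    calc _ ≤ 1 / (stepY m * stepX n) * (3 * M * (2 * stepX n)) :=
          mul_le_mul hD (key _ _ _ _ _ _ _ h0 h1 h2 p2 p0 p1) (abs_nonneg _) (by positivity)
      _ = 6 * M / stepY m := by field_simp; ring
  · simp only [rtInterp, Prod.smul_snd, Prod.snd_add, Prod.snd_sub, smul_eq_mul, abs_mul]
    calc _ ≤ 1 / (stepY m * stepX n) * (3 * M * stepY m) :=
          mul_le_mul hD (key _ _ _ _ _ _ _ h0 h1 h2 q2 q0 q1) (abs_nonneg _) (by positivity)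
      _ = 3 * M / stepX n := by field_simp

/-- The horizontal component of the field meets only the height of a side, the vertical component
only its width. -/
lemma abs_edgeFlux_le {ψ : ℝ × ℝ → ℝ × ℝ} {t : TriIndex n m} {M N : ℝ}
    (hψ : ∀ x ∈ cell (triangulation n m) t, |(ψ x).1| ≤ M ∧ |(ψ x).2| ≤ N) (i j : Fin 3) :
    |edgeFlux ψ (triangulation n m t i) (triangulation n m t j)|
      ≤ M * stepY m + N * (2 * stepX n) := by
  have ha := hψ _ (vertex_mem_cell t i)
  have hb := hψ _ (half_add_mem_cell t i j)
  have hc := hψ _ (vertex_mem_cell t j)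
  obtain ⟨hp, hq⟩ := abs_sub_le_of_mem_cell (vertex_mem_cell t j) (vertex_mem_cell t i)
  have key : ∀ a b c r : ℝ, |a| ≤ r → |b| ≤ r → |c| ≤ r → |1 / 6 * (a + 4 * b + c)| ≤ r := by
    intro a b c r h1 h2 h3
    rw [abs_le] at *
    constructor <;> linarith [h1.1, h1.2, h2.1, h2.2, h3.1, h3.2]
  have hM : 0 ≤ M := (abs_nonneg _).trans ha.1
  have hN : 0 ≤ N := (abs_nonneg _).trans ha.2
  simp only [edgeFlux, dot, normal, Prod.smul_fst, Prod.smul_snd, Prod.fst_add, Prod.snd_add,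
    smul_eq_mul]
  refine (abs_add_le _ _).trans (add_le_add ?_ ?_)
  · exact (abs_mul _ _).le.trans (mul_le_mul (key _ _ _ _ ha.1 hb.1 hc.1)
      ((abs_neg _).le.trans hq) (abs_nonneg _) hM)
  · exact (abs_mul _ _).le.trans (mul_le_mul (key _ _ _ _ ha.2 hb.2 hc.2) hp (abs_nonneg _) hN)

/-- Without a vertical component all fluxes are at most Y, which compensates the factor 1/Y in
`abs_rtInterp_le`. A vertical component would contribute X/Y, which is unbounded. -/
lemma abs_interpolant_horizField_le (hn : 1 ≤ n) (hnm : n ≤ m) {t : TriIndex n m} {x : ℝ × ℝ}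
    (hx : x ∈ cell (triangulation n m) t) :
    |(interpolant (triangulation n m) horizField t x).1| ≤ 6 ∧
      |(interpolant (triangulation n m) horizField t x).2| ≤ 3 := by
  have hm : 1 ≤ m := hn.trans hnm
  have hX := stepX_pos hn
  have hY := stepY_pos hm
  have hψ : ∀ x ∈ cell (triangulation n m) t, |(horizField x).1| ≤ 1 ∧ |(horizField x).2| ≤ 0 := by
    intro x hx
    obtain ⟨⟨h1, h2⟩, h3, h4⟩ := cell_mem_unitSquare hn hm hx
    refine ⟨?_, by simp [horizField]⟩
    simp only [horizField]
    have e1 : 0 ≤ x.1 ^ 2 / 2 - x.1 ^ 3 / 3 := by nlinarith [sq_nonneg x.1]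
    have e2 : x.1 ^ 2 / 2 - x.1 ^ 3 / 3 ≤ 1 / 6 := by nlinarith [sq_nonneg (x.1 - 1)]
    have e3 : 0 ≤ x.2 * (1 - x.2) := mul_nonneg h3 (by linarith)
    have e4 : x.2 * (1 - x.2) ≤ 1 / 4 := by nlinarith [sq_nonneg (x.2 - 1 / 2)]
    have e5 : 0 ≤ x.1 * (x.2 * (1 - x.2)) := mul_nonneg h1 e3
    have e6 : x.1 * (x.2 * (1 - x.2)) ≤ 1 / 4 := by nlinarith
    rw [abs_le]
    constructor <;> linarith
  have hF := abs_edgeFlux_le hψ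
  rw [one_mul, zero_mul, add_zero] at hF
  obtain ⟨h1, h2⟩ := abs_rtInterp_le hn hm hx (hF 0 1) (hF 1 2) (hF 2 0)
  refine ⟨h1.trans (by field_simp; norm_num), h2.trans ?_⟩
  rw [div_le_iff₀ hX]
  linarith [stepY_le_stepX hn hnm]

/-! ### Consistency of the two interpolants of the exact solution. -/

lemma abs_gradU_sub_le (hn : 1 ≤ n) (hm : 1 ≤ m) {t : TriIndex n m} {x y : ℝ × ℝ}
    (hx : x ∈ cell (triangulation n m) t) (hy : y ∈ cell (triangulation n m) t) :
    |(gradU x).1 - (gradU y).1| ≤ |x.1 - y.1| / 2 + |x.2 - y.2| ∧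
      |(gradU x).2 - (gradU y).2| ≤ |x.1 - y.1| + |x.2 - y.2| / 2 := by
  obtain ⟨⟨h1, h2⟩, h3, h4⟩ := cell_mem_unitSquare hn hm hx
  obtain ⟨⟨h1', h2'⟩, h3', h4'⟩ := cell_mem_unitSquare hn hm hy
  have e : ∀ z : ℝ, 0 ≤ z → z ≤ 1 → |z * (1 - z)| ≤ 1 / 4 := by
    intro z hz hz'
    rw [abs_of_nonneg (mul_nonneg hz (by linarith))]
    nlinarith [sq_nonneg (z - 1 / 2)]
  have e' : ∀ z : ℝ, 0 ≤ z → z ≤ 1 → |1 - 2 * z| ≤ 1 := by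
    intro z hz hz'
    rw [abs_le]; constructor <;> linarith
  have e'' : ∀ z w : ℝ, 0 ≤ z → z ≤ 1 → 0 ≤ w → w ≤ 1 → |1 - z - w| ≤ 1 := by
    intro z w hz hz' hw hw'
    rw [abs_le]; constructor <;> linarith
  constructor
  · have : (gradU x).1 - (gradU y).1 = -2 * (x.1 - y.1) * (x.2 * (1 - x.2))
        + (1 - 2 * y.1) * ((1 - x.2 - y.2) * (x.2 - y.2)) := by
      simp only [gradU]; ring
    rw [this]
    refine (abs_add_le _ _).trans (add_le_add ?_ ?_)
    · rw [abs_mul, abs_mul, abs_neg, abs_two]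
      nlinarith [e x.2 h3 h4, abs_nonneg (x.1 - y.1)]
    · rw [abs_mul, abs_mul]
      calc _ ≤ 1 * (1 * |x.2 - y.2|) := by
            gcongr
            · exact e' _ h1' h2'
            · exact e'' _ _ h3 h4 h3' h4'
        _ = _ := by ring
  · have : (gradU x).2 - (gradU y).2 = (1 - 2 * y.2) * ((1 - x.1 - y.1) * (x.1 - y.1))
        + -2 * (x.2 - y.2) * (x.1 * (1 - x.1)) := by
      simp only [gradU]; ring
    rw [this]
    refine (abs_add_le _ _).trans (add_le_add ?_ ?_)
    · rw [abs_mul, abs_mul]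
      calc _ ≤ 1 * (1 * |x.1 - y.1|) := by
            gcongr
            · exact e' _ h3' h4'
            · exact e'' _ _ h1 h2 h1' h2'
        _ = _ := by ring
    · rw [abs_mul, abs_mul, abs_neg, abs_two]
      nlinarith [e x.1 h1 h2, abs_nonneg (x.2 - y.2)]

lemma abs_gradU_sub_apex_le (hn : 1 ≤ n) (hnm : n ≤ m) {t : TriIndex n m} {x : ℝ × ℝ}
    (hx : x ∈ cell (triangulation n m) t) :
    |(gradU x).1 - (gradU (triangulation n m t 0)).1| ≤ 2 * stepX n ∧
      |(gradU x).2 - (gradU (triangulation n m t 0)).2| ≤ 2 * stepX n := by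
  have h := stepY_le_stepX hn hnm
  obtain ⟨h1, h2⟩ := abs_sub_apex_le hx
  obtain ⟨h3, h4⟩ := abs_gradU_sub_le hn (hn.trans hnm) hx (vertex_mem_cell t 0)
  constructor <;> linarith [stepX_pos hn]

lemma stepX_le_sq_div (hn : 1 ≤ n) (hnm : n ≤ m) : stepX n ≤ stepX n ^ 2 / stepY m := by
  rw [le_div_iff₀ (stepY_pos (hn.trans hnm)), sq]
  exact mul_le_mul_of_nonneg_left (stepY_le_stepX hn hnm) (stepX_pos hn).le

/-- After subtraction of the value at the apex, the field is at most 2X, so its fluxes are at most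
2XY + 4X² ≤ 6X². Division by Y gives κ. -/
lemma abs_interpolant_gradU_sub_le (hn : 1 ≤ n) (hnm : n ≤ m) {t : TriIndex n m} {x : ℝ × ℝ}
    (hx : x ∈ cell (triangulation n m) t) :
    |(interpolant (triangulation n m) gradU t x).1 - (gradU (triangulation n m t 0)).1|
        ≤ 36 * (stepX n ^ 2 / stepY m) ∧
      |(interpolant (triangulation n m) gradU t x).2 - (gradU (triangulation n m t 0)).2|
        ≤ 36 * (stepX n ^ 2 / stepY m) := by
  have hm : 1 ≤ m := hn.trans hnm
  have hX := stepX_pos hn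
  have hY := stepY_pos hm
  have hXY := stepY_le_stepX hn hnm
  have hF := abs_edgeFlux_le (ψ := fun y => gradU y - gradU (triangulation n m t 0))
    fun y hy => abs_gradU_sub_apex_le hn hnm hy
  have hF' : ∀ i j, |edgeFlux (fun y => gradU y - gradU (triangulation n m t 0))
      (triangulation n m t i) (triangulation n m t j)| ≤ 6 * stepX n ^ 2 := fun i j =>
    (hF i j).trans (by nlinarith)
  obtain ⟨h1, h2⟩ := abs_rtInterp_le hn hm hx (hF' 0 1) (hF' 1 2) (hF' 2 0)
  have heq := rtInterp_edgeFlux_sub_const gradU (gradU (triangulation n m t 0)) _ _ _ x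
    (nondegenerate_triangulation hn hm t)
  rw [← heq] at h1 h2
  refine ⟨h1.trans (le_of_eq (by ring)), h2.trans ?_⟩
  have := stepX_le_sq_div hn hnm
  have e : 3 * (6 * stepX n ^ 2) / stepX n = 18 * stepX n := by field_simp; ring
  rw [e]
  linarith

/-- The gradient of the nonconforming interpolant of `modelU`. -/
noncomputable def crInterpGrad (t : TriIndex n m) : ℝ × ℝ :=
  crGrad t (modelU ((1 / 2 : ℝ) • (triangulation n m t 2 + triangulation n m t 0)))
    (modelU ((1 / 2 : ℝ) • (triangulation n m t 0 + triangulation n m t 1)))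
    (modelU ((1 / 2 : ℝ) • (triangulation n m t 1 + triangulation n m t 2)))

lemma abs_modelU_taylor_le (hn : 1 ≤ n) (hnm : n ≤ m) {t : TriIndex n m} {x : ℝ × ℝ}
    (hx : x ∈ cell (triangulation n m) t) :
    |modelU x - modelU (triangulation n m t 0)
      - dot (gradU (triangulation n m t 0)) (x - triangulation n m t 0)| ≤ 3 * stepX n ^ 2 := by
  have hm : 1 ≤ m := hn.trans hnm
  have hX := stepX_pos hn
  have hX' := stepX_le_half hn
  have hXY := stepY_le_stepX hn hnm
  obtain ⟨hd, he⟩ := abs_sub_apex_le hx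
  obtain ⟨⟨h1, h2⟩, h3, h4⟩ := cell_mem_unitSquare hn hm (vertex_mem_cell t 0)
  generalize triangulation n m t 0 = y at *
  have he := he.trans hXY
  set b := stepX n
  set d := x.1 - y.1
  set e := x.2 - y.2
  have e1 : ∀ z : ℝ, 0 ≤ z → z ≤ 1 → |z * (1 - z)| ≤ 1 / 4 := by
    intro z hz hz'
    rw [abs_of_nonneg (mul_nonneg hz (by linarith))]
    nlinarith [sq_nonneg (z - 1 / 2)]
  have e2 : ∀ z : ℝ, 0 ≤ z → z ≤ 1 → |1 - 2 * z| ≤ 1 := by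
    intro z hz hz'
    rw [abs_le]; constructor <;> linarith
  -- Exact Taylor remainder of the biquadratic polynomial. Cubic and quartic terms are reduced to
  -- quadratic ones with |d|, |e| ≤ 1/2; the coefficients add up to 11/4.
  have key : modelU x - modelU y - dot (gradU y) (x - y)
      = -(y.1 * (1 - y.1) * (e * e)) + ((1 - 2 * y.1) * (1 - 2 * y.2) * (d * e)
        - (1 - 2 * y.1) * e * (d * e) - (y.2 * (1 - y.2)) * (d * d) - (1 - 2 * y.2) * e * (d * d)
        + e * d * (d * e)) := by
    simp only [modelU, gradU, dot, Prod.fst_sub, Prod.snd_sub, d, e]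
    ring
  have m1 : ∀ c p q : ℝ, ∀ C, |c| ≤ C → |p| ≤ b → |q| ≤ b → |c * (p * q)| ≤ C * b ^ 2 := by
    intro c p q C hc hp hq
    rw [abs_mul, abs_mul, sq]
    have : 0 ≤ C := (abs_nonneg _).trans hc
    gcongr
  have m2 : ∀ c p C D : ℝ, |c| ≤ C → |p| ≤ D → |c * p| ≤ C * D := by
    intro c p C D hc hp
    rw [abs_mul]
    have : 0 ≤ C := (abs_nonneg _).trans hc
    gcongr
  have he' : |e| ≤ 1 / 2 := he.trans hX'
  have hd' : |d| ≤ 1 / 2 := hd.trans hX'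
  have t1 := m1 _ e e _ (e1 y.1 h1 h2) he he
  have t2 := m1 _ d e _ (m2 _ _ _ _ (e2 y.1 h1 h2) (e2 y.2 h3 h4)) hd he
  have t3 := m1 _ d e _ (m2 _ _ _ _ (e2 y.1 h1 h2) he') hd he
  have t4 := m1 _ d d _ (e1 y.2 h3 h4) hd hd
  have t5 := m1 _ d d _ (m2 _ _ _ _ (e2 y.2 h3 h4) he') hd hd
  have t6 := m1 _ d e _ (m2 _ _ _ _ he' hd') hd he
  rw [key]
  rw [abs_le] at *
  have := sq_nonneg b
  constructor <;> linarith [t1.1, t1.2, t2.1, t2.2, t3.1, t3.2, t4.1, t4.2, t5.1, t5.2, t6.1, t6.2]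

lemma abs_crGrad_le (hn : 1 ≤ n) (hm : 1 ≤ m) (t : TriIndex n m) {vR vL vH M : ℝ}
    (hR : |vR| ≤ M) (hL : |vL| ≤ M) (hH : |vH| ≤ M) :
    |(crGrad t vR vL vH).1| ≤ 4 * M / stepX n ∧
      |(crGrad t vR vL vH).2| ≤ 4 * M / stepY m := by
  have hX := stepX_pos hn
  have hY := stepY_pos hm
  have hM : 0 ≤ M := (abs_nonneg _).trans hR
  have hs := leg_add_pos hn t
  have hs' := stepX_le_leg_add hn t
  have hl := legL_nonneg t
  have hr := legR_nonneg t
  rw [abs_le] at hR hL hH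
  constructor
  · simp only [crGrad, abs_div, abs_mul, abs_two, abs_of_pos hs]
    have : |vR - vL| ≤ 2 * M := abs_le.2 ⟨by linarith, by linarith⟩
    calc 2 * |vR - vL| / (legL t + legR t) ≤ 2 * (2 * M) / stepX n := by gcongr
      _ = 4 * M / stepX n := by ring
  · simp only [crGrad, abs_div, abs_mul, abs_neg, abs_two, abs_dirY, abs_of_pos hs,
      abs_of_pos hY]
    have : |legR t * (vR - vH) + legL t * (vL - vH)| ≤ 2 * M * (legL t + legR t) := by
      have h1 : |vR - vH| ≤ 2 * M := abs_le.2 ⟨by linarith, by linarith⟩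
      have h2 : |vL - vH| ≤ 2 * M := abs_le.2 ⟨by linarith, by linarith⟩
      refine (abs_add_le _ _).trans ?_
      rw [abs_mul, abs_mul, abs_of_nonneg hl, abs_of_nonneg hr]
      nlinarith
    calc 2 * 1 * |legR t * (vR - vH) + legL t * (vL - vH)| / (stepY m * (legL t + legR t))
        ≤ 2 * 1 * (2 * M * (legL t + legR t)) / (stepY m * (legL t + legR t)) := by gcongr
      _ = 4 * M / stepY m := by field_simp; ring

/-- `crGrad` is exact for affine functions. -/
lemma crGrad_sub_affine (hn : 1 ≤ n) (hm : 1 ≤ m) (t : TriIndex n m) (vR vL vH c : ℝ)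
    (g : ℝ × ℝ) :
    crGrad t vR vL vH - g = crGrad t
      (vR - c - dot g ((1 / 2 : ℝ) • (triangulation n m t 2 + triangulation n m t 0)
        - triangulation n m t 0))
      (vL - c - dot g ((1 / 2 : ℝ) • (triangulation n m t 0 + triangulation n m t 1)
        - triangulation n m t 0))
      (vH - c - dot g ((1 / 2 : ℝ) • (triangulation n m t 1 + triangulation n m t 2)
        - triangulation n m t 0)) := by
  have h1 := (leg_add_pos hn t).ne'
  have h2 := (stepY_pos hm).ne'
  simp only [crGrad, dot, vertex_zero, vertex_one, vertex_two]
  ext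
  · simp
    field_simp
    ring
  · simp
    rcases dirY_eq t with hs | hs <;> rw [hs] <;> field_simp <;> ring

/-- By `crGrad_sub_affine` only the second-order Taylor remainders at the three midpoints count, and
the vertical difference quotient divides these O(X²) quantities by Y. -/
lemma abs_crInterpGrad_sub_le (hn : 1 ≤ n) (hnm : n ≤ m) (t : TriIndex n m) :
    |(crInterpGrad t).1 - (gradU (triangulation n m t 0)).1| ≤ 24 * (stepX n ^ 2 / stepY m) ∧
      |(crInterpGrad t).2 - (gradU (triangulation n m t 0)).2|
        ≤ 24 * (stepX n ^ 2 / stepY m) := by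
  have hm : 1 ≤ m := hn.trans hnm
  have hX := stepX_pos hn
  obtain ⟨h1, h2⟩ := abs_crGrad_le hn hm t
    (abs_modelU_taylor_le hn hnm (half_add_mem_cell t 2 0))
    (abs_modelU_taylor_le hn hnm (half_add_mem_cell t 0 1))
    (abs_modelU_taylor_le hn hnm (half_add_mem_cell t 1 2))
  rw [← crGrad_sub_affine hn hm] at h1 h2
  have h3 := stepX_le_sq_div hn hnm
  have e : 4 * (3 * stepX n ^ 2) / stepX n = 12 * stepX n := by field_simp; ring
  have e' : 4 * (3 * stepX n ^ 2) / stepY m = 12 * (stepX n ^ 2 / stepY m) := by ring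
  rw [e] at h1
  rw [e'] at h2
  exact ⟨h1.trans (by linarith), h2.trans (by linarith)⟩

/-- Contributions of the two sides of an interior slanted edge cancel. With the cyclic numbering of
a row this is a reindexing of the sum, and the wrap-around terms carry the value zero. -/
lemma sum_fluxR_add_fluxL {τ : TriIndex n m → ℝ × ℝ → ℝ × ℝ}
    (hτ : τ ∈ raviartThomas (triangulation n m)) {vR vL : TriIndex n m → ℝ}
    (h : ∀ t : TriIndex n m, (t.1.1 : ℕ) < 2 * n → vL (rightNbr t) = vR t)
    (h0 : ∀ t : TriIndex n m, (t.1.1 : ℕ) = 0 → vL t = 0)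
    (h1 : ∀ t : TriIndex n m, (t.1.1 : ℕ) = 2 * n → vR t = 0) :
    ∑ t, (vR t * fluxR τ t + vL t * fluxL τ t) = 0 := by
  rw [Finset.sum_add_distrib, ← Equiv.sum_comp rightNbr (fun t => vL t * fluxL τ t),
    ← Finset.sum_add_distrib]
  refine Finset.sum_eq_zero fun t _ => ?_
  rcases lt_or_eq t with ht | ht
  · rw [h t ht, ← mul_add, fluxR_add_fluxL hτ ht, mul_zero]
  · rw [h1 t ht, h0 _ (rightNbr_of_eq ht).1]
    ring

/-- The involution pairs the two triangles at a horizontal side, so adding the sum to its reindexed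
copy gives zero. -/
lemma sum_fluxH {τ : TriIndex n m → ℝ × ℝ → ℝ × ℝ}
    (hτ : τ ∈ raviartThomas (triangulation n m)) {v : TriIndex n m → ℝ}
    (h : ∀ t, v (horizNbr t) = v t)
    (h0 : ∀ t : TriIndex n m, ((t.1.2.2 : ℕ) = 0 ∨ (t.1.2.2 : ℕ) = 2 * m) → v t = 0) :
    ∑ t, v t * fluxH τ t = 0 := by
  have h2 : ∑ t, v t * fluxH τ t + ∑ t, v t * fluxH τ t = 0 := by
    nth_rewrite 2 [← Equiv.sum_comp horizNbr (fun t => v t * fluxH τ t)]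
    rw [← Finset.sum_add_distrib]
    refine Finset.sum_eq_zero fun t _ => ?_
    by_cases ht : (t.1.2.2 : ℕ) = 0 ∨ (t.1.2.2 : ℕ) = 2 * m
    · rw [h t, h0 t ht]; ring
    · rw [h t, ← mul_add, fluxH_add_fluxH hτ ht, mul_zero]
  linarith

/-- Discrete integration by parts: the fields have no divergence, interior side terms cancel, and u
vanishes on the boundary. -/
lemma crInterpGrad_orthogonal (hn : 1 ≤ n) (hm : 1 ≤ m) {a : TriIndex n m → ℝ × ℝ}
    (ha : a ∈ constFields (triangulation n m)) :
    ∑ t, ∫ _ in cell (triangulation n m) t, dot (crInterpGrad t) (a t) = 0 := by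
  have hτ : (fun t _ => a t) ∈ raviartThomas (triangulation n m) := ha
  have hX := stepX_mul hn
  have hY := stepY_mul hm
  have key : ∀ t, ∫ _ in cell (triangulation n m) t, dot (crInterpGrad t) (a t)
      = (modelU ((1 / 2 : ℝ) • (triangulation n m t 2 + triangulation n m t 0))
          * fluxR (fun t _ => a t) t
        + modelU ((1 / 2 : ℝ) • (triangulation n m t 0 + triangulation n m t 1))
          * fluxL (fun t _ => a t) t)
        + modelU ((1 / 2 : ℝ) • (triangulation n m t 1 + triangulation n m t 2))
          * fluxH (fun t _ => a t) t := by
    intro t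
    have h1 := integral_dot_crGrad hn hm hτ t
      (modelU ((1 / 2 : ℝ) • (triangulation n m t 2 + triangulation n m t 0)))
      (modelU ((1 / 2 : ℝ) • (triangulation n m t 0 + triangulation n m t 1)))
      (modelU ((1 / 2 : ℝ) • (triangulation n m t 1 + triangulation n m t 2)))
    have h2 : ∀ x, div (fun _ : ℝ × ℝ => a t) x = 0 := by
      intro x
      rw [div_affine (a := a t) (b := 0) (by simp)]
      simp
    simp only [h2, integral_zero, mul_zero, sub_zero] at h1
    rw [← h1]
    simp only [crInterpGrad, dot_comm]
  simp only [key]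
  rw [Finset.sum_add_distrib, sum_fluxR_add_fluxL hτ
    (vR := fun t => modelU ((1 / 2 : ℝ) • (triangulation n m t 2 + triangulation n m t 0)))
    (vL := fun t => modelU ((1 / 2 : ℝ) • (triangulation n m t 0 + triangulation n m t 1))),
    sum_fluxH hτ
    (v := fun t => modelU ((1 / 2 : ℝ) • (triangulation n m t 1 + triangulation n m t 2))),
    add_zero]
  · intro t
    by_cases ht : (t.1.2.2 : ℕ) = 0 ∨ (t.1.2.2 : ℕ) = 2 * m
    · simp only [horizNbr_of_boundary ht]
    · simp only [vertex_horizNbr ht]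
  · intro t ht
    have hy : ((t.1.2.1 : ℕ) : ℝ) * stepY m + dirY t * stepY m = (t.1.2.2 : ℕ) * stepY m := by
      rw [dirY]; ring
    simp only [vertex_one, vertex_two, hy, modelU]
    rcases ht with ht | ht <;> rw [ht]
    · simp
    · have : ((2 * m : ℕ) : ℝ) * stepY m = 1 := by push_cast; exact hY
      simp only [this]
      norm_num
  · intro t ht
    simp only [vertex_rightNbr ht]
  · intro t ht
    simp [vertex_one, vertex_zero, modelU, legL, ht]
  · intro t ht
    simp only [vertex_two, vertex_zero, modelU, legR, ht, if_true]
    have : ((2 * m : ℕ) : ℝ) * stepY m = 1 := by push_cast; exact hY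
    have : ((2 * n : ℕ) : ℝ) * stepX n = 1 := by push_cast; exact hX
    simp only [this]
    norm_num

/-! ### The energy estimate. -/

lemma continuous_error {σ : TriIndex n m → ℝ × ℝ → ℝ × ℝ}
    (hσ : σ ∈ raviartThomas (triangulation n m)) (t : TriIndex n m) :
    Continuous fun x => grad modelU x - σ t x := by
  rw [grad_modelU]
  exact continuous_gradU.sub (continuous_of_mem hσ t)

/-- The terms with `a` sum to zero after integration, so the estimate of ‖a‖ by orthogonality can be
carried out pointwise inside the hypothesis `h`. -/
lemma fluxError_le_sqrt (hn : 1 ≤ n) (hm : 1 ≤ m) {σ : TriIndex n m → ℝ × ℝ → ℝ × ℝ}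
    (hσ : σ ∈ raviartThomas (triangulation n m)) {a g : TriIndex n m → ℝ × ℝ} {M : ℝ}
    (ha : ∑ t, ∫ x in cell (triangulation n m) t, dot (σ t x) (a t) = 0)
    (hg : ∑ t, ∫ _ in cell (triangulation n m) t, dot (g t) (a t) = 0) (hM : 0 ≤ M)
    (h : ∀ t, ∀ x ∈ cell (triangulation n m) t,
      dot (grad modelU x - σ t x) (grad modelU x - σ t x)
        ≤ M + 4 * (dot (σ t x) (a t) - dot (g t) (a t))) :
    fluxError (triangulation n m) modelU σ ≤ Real.sqrt (3 / 2 * M) := by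
  have hT := nondegenerate_triangulation hn hm
  refine Real.sqrt_le_sqrt ?_
  have h1 : ∀ t, ∫ x in cell (triangulation n m) t,
      dot (grad modelU x - σ t x) (grad modelU x - σ t x)
      ≤ area (triangulation n m) t * M + 4 * ((∫ x in cell (triangulation n m) t, dot (σ t x) (a t))
        - ∫ _ in cell (triangulation n m) t, dot (g t) (a t)) := by
    intro t
    have i1 := integrableOn_cell (triangulation n m) t
      (continuous_dot (continuous_of_mem hσ t) (continuous_const (y := a t)))
    have i2 := integrableOn_cell (triangulation n m) t (continuous_const (y := dot (g t) (a t)))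
    have i3 := integrableOn_cell (triangulation n m) t (continuous_const (y := M))
    have i4 : IntegrableOn (fun x => 4 * (dot (σ t x) (a t) - dot (g t) (a t)))
      (cell (triangulation n m) t) := (i1.sub i2).const_mul 4
    rw [← integral_cell_const _ t (hT t), ← integral_sub i1 i2, ← integral_const_mul,
      ← integral_add i3 i4]
    exact setIntegral_mono_on (integrableOn_cell _ t
      (continuous_dot (continuous_error hσ t) (continuous_error hσ t)))
      (i3.add i4) (measurableSet_cell _ t) (h t)
  refine (Finset.sum_le_sum fun t _ => h1 t).trans ?_
  rw [Finset.sum_add_distrib, ← Finset.mul_sum, Finset.sum_sub_distrib, ha, hg, ← Finset.sum_mul]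
  have := mul_le_mul_of_nonneg_right (sum_area_le hn hm) hM
  linarith

lemma fluxError_le_const (hn : 1 ≤ n) (hnm : n ≤ m) {σ : TriIndex n m → ℝ × ℝ → ℝ × ℝ}
    (hσ : IsMixedFlux (triangulation n m) modelF σ) :
    fluxError (triangulation n m) modelU σ ≤ 174 := by
  have hm : 1 ≤ m := hn.trans hnm
  have hT := nondegenerate_triangulation hn hm
  obtain ⟨p, hp⟩ := hσ
  obtain ⟨a, ha, hsub⟩ := exists_constField_sub_eq hT hp.1 (interpolant_mem hT horizField)
    (fun t => by rw [hp.integral_div, integral_div_interpolant hT edgeFlux_horizField])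
  -- With a = s - τ, |u - s|² ≤ 2|u|² + 2|s|² and 4 s·a = 2|s|² + 2|a|² - 2|τ|², so M = 2|u|² +
  -- 2|τ|² suffices; this is at most 4 + 90.
  refine (fluxError_le_sqrt hn hm hp.1 (hp.orthogonal ha) (g := 0) (M := 100) (by simp [dot])
    (by norm_num) ?_).trans ?_
  · intro t x hx
    obtain ⟨h1, h2⟩ := abs_interpolant_horizField_le hn hnm hx
    obtain ⟨⟨h3, h4⟩, h5, h6⟩ := cell_mem_unitSquare hn hm hx
    have h7 := hsub t x
    have hu : |(gradU x).1| ≤ 1 ∧ |(gradU x).2| ≤ 1 := by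
      have e : ∀ z w : ℝ, 0 ≤ z → z ≤ 1 → 0 ≤ w → w ≤ 1 → |(1 - 2 * z) * (w * (1 - w))| ≤ 1 := by
        intro z w hz hz' hw hw'
        rw [abs_mul]
        refine mul_le_one₀ (abs_le.2 ⟨by linarith, by linarith⟩) (abs_nonneg _)
          (abs_le.2 ⟨by nlinarith, by nlinarith⟩)
      exact ⟨e _ _ h3 h4 h5 h6, by simp only [gradU]; rw [mul_comm]; exact e _ _ h5 h6 h3 h4⟩
    rw [grad_modelU]
    generalize interpolant (triangulation n m) horizField t x = τ at *
    rw [← h7]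
    generalize σ t x = s at *
    generalize gradU x = u at *
    rw [← sq_le_one_iff_abs_le_one, ← sq_le_one_iff_abs_le_one] at hu
    have h1' := sq_le_sq' (abs_le.1 h1).1 (abs_le.1 h1).2
    have h2' := sq_le_sq' (abs_le.1 h2).1 (abs_le.1 h2).2
    simp only [dot, Prod.fst_sub, Prod.snd_sub, Pi.zero_apply, Prod.fst_zero, Prod.snd_zero]
    nlinarith [sq_nonneg (u.1 + s.1), sq_nonneg (u.2 + s.2), sq_nonneg (s.1 - τ.1),
      sq_nonneg (s.2 - τ.2)]
  · rw [Real.sqrt_le_left (by norm_num)]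
    norm_num

lemma fluxError_le_sq_div (hn : 1 ≤ n) (hnm : n ≤ m) {σ : TriIndex n m → ℝ × ℝ → ℝ × ℝ}
    (hσ : IsMixedFlux (triangulation n m) modelF σ) :
    fluxError (triangulation n m) modelU σ ≤ 174 * (stepX n ^ 2 / stepY m) := by
  have hm : 1 ≤ m := hn.trans hnm
  have hT := nondegenerate_triangulation hn hm
  obtain ⟨p, hp⟩ := hσ
  obtain ⟨a, ha, hsub⟩ := exists_constField_sub_eq hT hp.1 (interpolant_mem hT gradU)
    (fun t => by rw [hp.integral_div, integral_div_interpolant hT edgeFlux_gradU])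
  have hκ : 0 ≤ stepX n ^ 2 / stepY m := (stepX_pos hn).le.trans (stepX_le_sq_div hn hnm)
  -- With a = s - τ, |u - s|² ≤ 2|u - τ|² + 2|a|², and 4(s - g)·a ≥ 2|a|² - 2|g - τ|². The
  -- components of u - τ and g - τ are at most 38κ and 60κ, and 20176 = 4(38² + 60²).
  refine (fluxError_le_sqrt hn hm hp.1 (hp.orthogonal ha) (crInterpGrad_orthogonal hn hm ha)
    (M := 20176 * (stepX n ^ 2 / stepY m) ^ 2) (by positivity) ?_).trans ?_
  · intro t x hx
    obtain ⟨h1, h2⟩ := abs_interpolant_gradU_sub_le hn hnm hx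
    obtain ⟨h3, h4⟩ := abs_crInterpGrad_sub_le hn hnm t
    obtain ⟨h5, h6⟩ := abs_gradU_sub_apex_le hn hnm hx
    have h7 := hsub t x
    have h8 := stepX_le_sq_div hn hnm
    rw [grad_modelU]
    generalize interpolant (triangulation n m) gradU t x = τ at *
    rw [← h7]
    generalize σ t x = s at *
    generalize gradU x = u at *
    generalize gradU (triangulation n m t 0) = u₀ at *
    generalize crInterpGrad t = g at *
    generalize stepX n ^ 2 / stepY m = κ at *
    rw [abs_le] at *
    have d1 := sq_le_sq' (show -(38 * κ) ≤ u.1 - τ.1 by linarith) (by linarith)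
    have d2 := sq_le_sq' (show -(38 * κ) ≤ u.2 - τ.2 by linarith) (by linarith)
    have d3 := sq_le_sq' (show -(60 * κ) ≤ g.1 - τ.1 by linarith) (by linarith)
    have d4 := sq_le_sq' (show -(60 * κ) ≤ g.2 - τ.2 by linarith) (by linarith)
    simp only [dot, Prod.fst_sub, Prod.snd_sub]
    nlinarith [sq_nonneg (u.1 - τ.1 + (s.1 - τ.1)), sq_nonneg (u.2 - τ.2 + (s.2 - τ.2)),
      sq_nonneg (g.1 - τ.1 - (s.1 - τ.1)), sq_nonneg (g.2 - τ.2 - (s.2 - τ.2))]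
  · rw [Real.sqrt_le_left (by positivity)]
    nlinarith [sq_nonneg (stepX n ^ 2 / stepY m)]

lemma sq_div_eq (hn : 1 ≤ n) (hm : 1 ≤ m) :
    stepX n ^ 2 / stepY m = (m : ℝ) / (n : ℝ) ^ 2 / 2 := by
  have h1 : (n : ℝ) ≠ 0 := by exact_mod_cast (by omega : n ≠ 0)
  have h2 : (m : ℝ) ≠ 0 := by exact_mod_cast (by omega : m ≠ 0)
  unfold stepX stepY
  field_simp

theorem fluxError_le (hn : 1 ≤ n) (hnm : n ≤ m) {σ : TriIndex n m → ℝ × ℝ → ℝ × ℝ}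
    (hσ : IsMixedFlux (triangulation n m) modelF σ) :
    fluxError (triangulation n m) modelU σ ≤ 174 * min 1 ((m : ℝ) / (n : ℝ) ^ 2) := by
  have h1 := fluxError_le_const hn hnm hσ
  have h2 := fluxError_le_sq_div hn hnm hσ
  rw [sq_div_eq hn (hn.trans hnm)] at h2
  have h3 : (0 : ℝ) ≤ (m : ℝ) / (n : ℝ) ^ 2 := by positivity
  rcases min_choice 1 ((m : ℝ) / (n : ℝ) ^ 2) with h | h <;> rw [h] <;> linarith

end Upper

end RTMixed

namespace RTMixed

/-! ### The lower bound -/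

section Lower

lemma sum_sq_odd (N : ℕ) (c : ℝ) : ∑ k ∈ Finset.range N, (1 - c * (2 * k + 1)) ^ 2
    = N - 2 * c * N ^ 2 + c ^ 2 * (4 * N ^ 3 - N) / 3 := by
  induction N with
  | zero => simp
  | succ N ih => rw [Finset.sum_range_succ, ih]; push_cast; ring

lemma sum_pow_four_odd (N : ℕ) (c : ℝ) : ∑ k ∈ Finset.range N, (1 - c * (2 * k + 1)) ^ 4
    = N - 4 * c * N ^ 2 + 2 * c ^ 2 * (4 * N ^ 3 - N) - 4 * c ^ 3 * (2 * N ^ 4 - N ^ 2)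
      + c ^ 4 * (48 * N ^ 5 - 40 * N ^ 3 + 7 * N) / 15 := by
  induction N with
  | zero => simp
  | succ N ih => rw [Finset.sum_range_succ, ih]; push_cast; ring

/-- The horizontal profile of the test function. -/
def profile (z : ℝ) : ℝ := z * (1 - z) * (1 - 2 * z)

lemma abs_profile_le {z : ℝ} (h0 : 0 ≤ z) (h1 : z ≤ 1) : |profile z| ≤ 1 / 4 := by
  have e1 : |z * (1 - z)| ≤ 1 / 4 := by
    rw [abs_of_nonneg (mul_nonneg h0 (by linarith))]
    nlinarith [sq_nonneg (z - 1 / 2)]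
  have e2 : |1 - 2 * z| ≤ 1 := abs_le.2 ⟨by linarith, by linarith⟩
  rw [profile, abs_mul]
  nlinarith [abs_nonneg (1 - 2 * z)]

lemma abs_profile_sub_le {y z : ℝ} (hy : 0 ≤ y) (hy' : y ≤ 1) (hz : 0 ≤ z) (hz' : z ≤ 1) :
    |profile z - profile y| ≤ |z - y| := by
  have : profile z - profile y
      = (1 - 3 * (z + y) + 2 * (z ^ 2 + z * y + y ^ 2)) * (z - y) := by
    simp only [profile]; ring
  rw [this, abs_mul]
  refine mul_le_of_le_one_left (abs_nonneg _) (abs_le.2 ⟨?_, ?_⟩)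
  · nlinarith [sq_nonneg (z + y - 1), sq_nonneg (z - y), mul_nonneg hy hz]
  · nlinarith [mul_nonneg hy hz, mul_nonneg hy (sub_nonneg.2 hy'), mul_nonneg hz (sub_nonneg.2 hz'),
      mul_nonneg hy (sub_nonneg.2 hz'), mul_nonneg hz (sub_nonneg.2 hy')]

variable {n m : ℕ}

/-- The vertical profile of the test function, constant on each row. -/
noncomputable def rowWeight (m j : ℕ) : ℝ := 1 - stepY m * (2 * j + 1)

/-- The value of the test function at the midpoint of the right side. -/
noncomputable def testR (t : TriIndex n m) : ℝ :=
  dirY t * (legR t * profile ((t.1.1 : ℕ) * stepX n + legR t / 2)) * rowWeight m (row t)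

/-- The value of the test function at the midpoint of the left side. -/
noncomputable def testL (t : TriIndex n m) : ℝ :=
  -(dirY t * (legL t * profile ((t.1.1 : ℕ) * stepX n - legL t / 2)) * rowWeight m (row t))

/-- The piecewise gradient of the test function, which vanishes at the midpoints of all
horizontal sides. -/
noncomputable def testGrad (t : TriIndex n m) : ℝ × ℝ := crGrad t (testR t) (testL t) 0

lemma abs_rowWeight_le (hm : 1 ≤ m) (t : TriIndex n m) : |rowWeight m (row t)| ≤ 1 := by
  have h1 := stepY_pos hm
  have h2 := stepY_mul hm
  have h3 : ((row t : ℕ) : ℝ) + 1 ≤ 2 * m := by exact_mod_cast row_lt t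
  have h4 : (0 : ℝ) ≤ row t := Nat.cast_nonneg _
  rw [rowWeight, abs_le]
  constructor <;> nlinarith

lemma midR_mem (hn : 1 ≤ n) (t : TriIndex n m) :
    0 ≤ (t.1.1 : ℕ) * stepX n + legR t / 2 ∧ (t.1.1 : ℕ) * stepX n + legR t / 2 ≤ 1 := by
  have h1 := apexX_mem hn t
  have h2 := legL_nonneg t
  have h3 := legR_nonneg t
  constructor <;> linarith

lemma midL_mem (hn : 1 ≤ n) (t : TriIndex n m) :
    0 ≤ (t.1.1 : ℕ) * stepX n - legL t / 2 ∧ (t.1.1 : ℕ) * stepX n - legL t / 2 ≤ 1 := by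
  have h1 := apexX_mem hn t
  have h2 := legL_nonneg t
  have h3 := legR_nonneg t
  constructor <;> linarith

lemma abs_testR_le (hn : 1 ≤ n) (hm : 1 ≤ m) (t : TriIndex n m) : |testR t| ≤ legR t / 4 := by
  have h1 := abs_profile_le (midR_mem hn t).1 (midR_mem hn t).2
  have h2 := abs_rowWeight_le hm t
  have h3 := legR_nonneg t
  rw [testR, abs_mul, abs_mul, abs_mul, abs_dirY, one_mul, abs_of_nonneg h3]
  calc _ ≤ legR t * (1 / 4) * 1 := by gcongr
    _ = _ := by ring

lemma abs_testL_le (hn : 1 ≤ n) (hm : 1 ≤ m) (t : TriIndex n m) : |testL t| ≤ legL t / 4 := by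
  have h1 := abs_profile_le (midL_mem hn t).1 (midL_mem hn t).2
  have h2 := abs_rowWeight_le hm t
  have h3 := legL_nonneg t
  rw [testL, abs_neg, abs_mul, abs_mul, abs_mul, abs_dirY, one_mul, abs_of_nonneg h3]
  calc _ ≤ legL t * (1 / 4) * 1 := by gcongr
    _ = _ := by ring

/-- The sign `dirY` changes across the side, which is why the left value is defined with a minus
sign: the test function has one value at each midpoint. -/
lemma testL_rightNbr {t : TriIndex n m} (h : (t.1.1 : ℕ) < 2 * n) :
    testL (rightNbr t) = testR t := by
  have h1 : legR t = stepX n := if_neg (by omega)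
  rw [testL, testR, dirY_rightNbr h, legL_rightNbr, row_rightNbr, (rightNbr_of_lt h).1, h1]
  push_cast
  rw [show ((t.1.1 : ℕ) + 1 : ℝ) * stepX n - stepX n / 2 = (t.1.1 : ℕ) * stepX n + stepX n / 2 by
    ring]
  ring

lemma testL_of_eq_zero {t : TriIndex n m} (h : (t.1.1 : ℕ) = 0) : testL t = 0 := by
  have h1 : legL t = 0 := if_pos h
  rw [testL, h1]; ring

lemma testR_of_eq {t : TriIndex n m} (h : (t.1.1 : ℕ) = 2 * n) : testR t = 0 := by
  rw [testR, legR_of_eq h]; ring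

lemma abs_testGrad_fst_le (hn : 1 ≤ n) (hm : 1 ≤ m) (t : TriIndex n m) :
    |(testGrad t).1| ≤ 1 / 2 := by
  have h1 := abs_le.1 (abs_testR_le hn hm t)
  have h2 := abs_le.1 (abs_testL_le hn hm t)
  have h3 := leg_add_pos hn t
  simp only [testGrad, crGrad]
  rw [abs_div, abs_of_pos h3, div_le_iff₀ h3, abs_le]
  constructor <;> linarith [h1.1, h1.2, h2.1, h2.2]

/-- The alternating sign of the test values meets the sign in the vertical derivative and
disappears. What remains is a difference of the profile across the triangle, the same for both
orientations. -/
lemma testGrad_snd (hn : 1 ≤ n) (hm : 1 ≤ m) (t : TriIndex n m) :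
    area (triangulation n m) t * (testGrad t).2
      = -(rowWeight m (row t) * (legR t ^ 2 * profile ((t.1.1 : ℕ) * stepX n + legR t / 2)
        - legL t ^ 2 * profile ((t.1.1 : ℕ) * stepX n - legL t / 2))) := by
  have h1 := (leg_add_pos hn t).ne'
  have h2 := (stepY_pos hm).ne'
  rw [area_triangulation hn hm]
  simp only [testGrad, crGrad, testR, testL]
  rcases dirY_eq t with hs | hs <;> rw [hs] <;> field_simp <;> ring

/-- In the interior this is the Lipschitz bound for the profile. In the end columns one term is
missing, but the profile vanishes at 0 and 1, so the other term has the same order X³. -/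
lemma abs_profile_legs_le (hn : 1 ≤ n) (t : TriIndex n m) :
    |legR t ^ 2 * profile ((t.1.1 : ℕ) * stepX n + legR t / 2)
      - legL t ^ 2 * profile ((t.1.1 : ℕ) * stepX n - legL t / 2)|
      ≤ stepX n ^ 2 * (legL t + legR t) / 2 := by
  have hX := stepX_pos hn
  have hR := midR_mem hn t
  have hL := midL_mem hn t
  have p0 : profile 0 = 0 := by simp [profile]
  have p1 : profile 1 = 0 := by simp [profile]
  have hnX := stepX_mul hn
  by_cases h0 : (t.1.1 : ℕ) = 0
  · have h1 : legL t = 0 := if_pos h0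
    have h2 : legR t = stepX n := if_neg (by omega)
    have h3 := abs_profile_sub_le le_rfl zero_le_one hR.1 hR.2
    rw [h0, h2] at *
    rw [h1, p0, sub_zero, sub_zero] at *
    simp only [Nat.cast_zero, zero_mul, zero_add] at *
    rw [abs_of_pos (half_pos hX)] at h3
    norm_num
    nlinarith [sq_nonneg (stepX n)]
  · have h1 : legL t = stepX n := if_neg h0
    by_cases h2n : (t.1.1 : ℕ) = 2 * n
    · have h2 : legR t = 0 := if_pos h2n
      have h3 := abs_profile_sub_le zero_le_one le_rfl hL.1 hL.2
      rw [h2n, h1] at *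
      rw [h2, p1, sub_zero] at *
      have e : ((2 * n : ℕ) : ℝ) * stepX n = 1 := by push_cast; exact hnX
      rw [e] at h3 ⊢
      rw [show (1 : ℝ) - stepX n / 2 - 1 = -(stepX n / 2) by ring, abs_neg,
        abs_of_pos (half_pos hX)] at h3
      norm_num
      nlinarith [sq_nonneg (stepX n)]
    · have h2 : legR t = stepX n := if_neg h2n
      have h3 := abs_profile_sub_le hL.1 hL.2 hR.1 hR.2
      rw [h1, h2] at *
      rw [show ((t.1.1 : ℕ) : ℝ) * stepX n + stepX n / 2 - ((t.1.1 : ℕ) * stepX n - stepX n / 2)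
        = stepX n by ring, abs_of_pos hX] at h3
      rw [← mul_sub, abs_mul, abs_of_pos (by positivity)]
      nlinarith [sq_nonneg (stepX n)]

lemma abs_testGrad_snd_le (hn : 1 ≤ n) (hm : 1 ≤ m) (t : TriIndex n m) :
    |(testGrad t).2| ≤ stepX n ^ 2 / stepY m := by
  have hY := stepY_pos hm
  have h1 := abs_profile_legs_le hn t
  have h2 := abs_rowWeight_le hm t
  have h3 := leg_add_pos hn t
  have h4 := congrArg abs (testGrad_snd hn hm t)
  rw [abs_mul, abs_neg, abs_mul, area_triangulation hn hm, abs_of_pos (by positivity)] at h4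
  have h5 : stepY m * (legL t + legR t) / 2 * |(testGrad t).2|
      ≤ stepX n ^ 2 * (legL t + legR t) / 2 := by
    rw [h4]
    exact (mul_le_of_le_one_left (abs_nonneg _) h2).trans h1
  rw [le_div_iff₀ hY]
  have h6 : (legL t + legR t) / 2 * (|(testGrad t).2| * stepY m)
      ≤ (legL t + legR t) / 2 * stepX n ^ 2 := by linarith
  exact le_of_mul_le_mul_left h6 (half_pos h3)

/-- The mixed flux is almost orthogonal to the gradient of the test function. -/
lemma abs_sum_flux_testGrad_le (hn : 1 ≤ n) (hm : 1 ≤ m)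
    {σ : TriIndex n m → ℝ × ℝ → ℝ × ℝ} {p : TriIndex n m → ℝ}
    (hσ : IsMixedSolution (triangulation n m) modelF σ p) :
    |∑ t, ∫ x in cell (triangulation n m) t, dot (σ t x) (testGrad t)| ≤ stepX n / 4 := by
  have hX := stepX_pos hn
  have h1 : ∀ t, ∫ x in cell (triangulation n m) t, dot (σ t x) (testGrad t)
      = (testR t * fluxR σ t + testL t * fluxL σ t)
        + ∫ x in cell (triangulation n m) t, (testR t + testL t) / 3 * modelF x := by
    intro t
    rw [testGrad, integral_dot_crGrad hn hm hσ.1, hσ.integral_div, integral_const_mul]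
    ring
  simp only [h1]
  rw [Finset.sum_add_distrib, sum_fluxR_add_fluxL hσ.1 (fun t ht => testL_rightNbr ht)
    (fun t ht => testL_of_eq_zero ht) (fun t ht => testR_of_eq ht), zero_add]
  -- The side terms are gone; only the load remains, tested with values of size X.
  refine (sum_integral_le hn hm (M := stepX n / 6) (by positivity) ?_).trans (by linarith)
  intro t x hx
  obtain ⟨⟨h2, h3⟩, h4, h5⟩ := cell_mem_unitSquare hn hm hx
  have e1 := abs_le.1 (abs_testR_le hn hm t)
  have e2 := abs_le.1 (abs_testL_le hn hm t)
  have e3 := legL_le t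
  have e4 := legR_le t
  have e5 : |modelF x| ≤ 1 := by
    rw [modelF, abs_le]
    constructor <;> nlinarith [sq_nonneg (x.1 - 1 / 2), sq_nonneg (x.2 - 1 / 2)]
  have e6 : |(testR t + testL t) / 3| ≤ stepX n / 6 := by
    rw [abs_le]; constructor <;> linarith [e1.1, e1.2, e2.1, e2.2]
  rw [abs_mul]
  nlinarith [abs_nonneg (modelF x), abs_nonneg ((testR t + testL t) / 3)]

/-- Freezing the first component of ∇u at the apex costs O(X), since the horizontal derivative of
the test function is bounded. The frozen sum is then summed by parts along rows: each side carries a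
value O(X) times a jump O(X) of the frozen coefficient. -/
lemma abs_sum_horizontal_le (hn : 1 ≤ n) (hnm : n ≤ m) :
    |∑ t : TriIndex n m, ∫ x in cell (triangulation n m) t, (gradU x).1 * (testGrad t).1|
      ≤ 9 / 4 * stepX n := by
  have hm : 1 ≤ m := hn.trans hnm
  have hX := stepX_pos hn
  have hY := stepY_pos hm
  have hT := nondegenerate_triangulation hn hm
  have hU : Continuous fun x => (gradU x).1 := continuous_fst.comp continuous_gradU
  let U : TriIndex n m → ℝ := fun t => (gradU (triangulation n m t 0)).1
  have h1 : ∀ t : TriIndex n m, ∫ x in cell (triangulation n m) t, (gradU x).1 * (testGrad t).1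
      = (∫ x in cell (triangulation n m) t, ((gradU x).1 - U t) * (testGrad t).1)
        + (stepY m * testR t * U t + -(stepY m * testL t * U t)) := by
    intro t
    rw [integral_mul_const, integral_mul_const,
      integral_sub (integrableOn_cell _ _ hU) (integrableOn_cell _ _ continuous_const),
      integral_cell_const _ _ (hT t), area_triangulation hn hm]
    have := (leg_add_pos hn t).ne'
    simp only [testGrad, crGrad]
    field_simp
    ring
  have h2 : |∑ t : TriIndex n m, ∫ x in cell (triangulation n m) t,
      ((gradU x).1 - U t) * (testGrad t).1| ≤ 3 / 2 * stepX n := by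
    refine sum_integral_le hn hm hX.le fun t x hx => ?_
    rw [abs_mul]
    calc _ ≤ 2 * stepX n * (1 / 2) := mul_le_mul (abs_gradU_sub_apex_le hn hnm hx).1
          (abs_testGrad_fst_le hn hm t) (abs_nonneg _) (by positivity)
      _ = stepX n := by ring
  have h3 : |∑ t : TriIndex n m, (stepY m * testR t * U t + -(stepY m * testL t * U t))|
      ≤ 3 / 4 * stepX n := by
    rw [Finset.sum_add_distrib,
      ← Equiv.sum_comp rightNbr (fun t : TriIndex n m => -(stepY m * testL t * U t)),
      ← Finset.sum_add_distrib]
    have h4 : ∀ t : TriIndex n m, |stepY m * testR t * U t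
        + -(stepY m * testL (rightNbr t) * U (rightNbr t))| ≤ stepY m * stepX n ^ 2 / 2 := by
      intro t
      rcases lt_or_eq t with ht | ht
      · rw [testL_rightNbr ht, show stepY m * testR t * U t + -(stepY m * testR t * U (rightNbr t))
          = -(stepY m * testR t * (U (rightNbr t) - U t)) by ring, abs_neg, abs_mul, abs_mul,
          abs_of_pos hY]
        have h5 := (abs_gradU_sub_apex_le hn hnm (vertex_mem_cell t 2)).1
        rw [← (vertex_rightNbr ht).1] at h5
        have h6 := (abs_testR_le hn hm t).trans (by linarith [legR_le t] : _ ≤ stepX n / 4)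
        calc _ ≤ stepY m * (stepX n / 4) * (2 * stepX n) := by
              refine mul_le_mul ?_ h5 (abs_nonneg _) (by positivity)
              gcongr
          _ = _ := by ring
      · rw [testR_of_eq ht, testL_of_eq_zero (rightNbr_of_eq ht).1]
        simp only [mul_zero, zero_mul, neg_zero, add_zero, abs_zero]
        positivity
    refine (Finset.abs_sum_le_sum_abs _ _).trans ((Finset.sum_le_sum fun t _ => h4 t).trans ?_)
    rw [sum_triIndex_const]
    have e1 := stepX_mul hn
    have e2 := stepY_mul hm
    have e3 := stepX_le_half hn
    calc (2 * (n : ℝ) + 1) * (2 * m) * (stepY m * stepX n ^ 2 / 2)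
        = (2 * n * stepX n + stepX n) * (2 * m * stepY m) * stepX n / 2 := by ring
      _ = (1 + stepX n) * stepX n / 2 := by rw [e1, e2]; ring
      _ ≤ 3 / 4 * stepX n := by nlinarith
  simp only [h1]
  rw [Finset.sum_add_distrib]
  refine (abs_add_le _ _).trans ?_
  linarith

/-- The horizontal distance from the left vertex to the apex of a triangle in column `i`. -/
noncomputable def colLegL (n i : ℕ) : ℝ := if i = 0 then 0 else stepX n

/-- The horizontal distance from the apex to the right vertex of a triangle in column `i`. -/
noncomputable def colLegR (n i : ℕ) : ℝ := if i = 2 * n then 0 else stepX n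

/-- The mean value of `x (1 - x)` over a triangle in column `i`. -/
noncomputable def colMean (n i : ℕ) : ℝ :=
  ((i * stepX n + (colLegR n i - colLegL n i) / 2)
      * (1 - (i * stepX n + (colLegR n i - colLegL n i) / 2))
    + (i * stepX n + colLegR n i / 2) * (1 - (i * stepX n + colLegR n i / 2))
    + (i * stepX n - colLegL n i / 2) * (1 - (i * stepX n - colLegL n i / 2))) / 3

lemma integral_colMean (hn : 1 ≤ n) (hm : 1 ≤ m) (t : TriIndex n m) :
    ∫ x in cell (triangulation n m) t, x.1 * (1 - x.1)
      = area (triangulation n m) t * colMean n t.1.1 := by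
  rw [integral_cell_quadratic _ t (nondegenerate_triangulation hn hm t) 0 1 0 (-1) 0 0
    (fun x => by ring)]
  have h1 : colLegL n t.1.1 = legL t := rfl
  have h2 : colLegR n t.1.1 = legR t := rfl
  rw [colMean, h1, h2]
  simp only [mid, vertex_zero, vertex_one, vertex_two]
  simp
  ring

/-- The increment in the interior is exactly X(1-2x), with x the midpoint between the columns. It is
smaller at the half triangles of the end columns; the factor 1/3 covers these cases down to n = 1,
where X = 1/2. -/
lemma colMean_sub_ge (hn : 1 ≤ n) {k : ℕ} (hk : k < 2 * n) :
    stepX n / 3 * (1 - stepX n * (2 * k + 1)) ^ 2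
      ≤ (1 - stepX n * (2 * k + 1)) * (colMean n (k + 1) - colMean n k) := by
  have hX := stepX_pos hn
  have hX' := stepX_le_half hn
  have hnX := stepX_mul hn
  have e2 : colLegR n k = stepX n := if_neg (by omega)
  have e3 : colLegL n (k + 1) = stepX n := if_neg (by omega)
  by_cases h0 : k = 0
  · subst h0
    have e1 : colLegL n 0 = 0 := if_pos rfl
    have e4 : colLegR n (0 + 1) = stepX n := if_neg (by omega)
    have e : colMean n (0 + 1) - colMean n 0 = stepX n * (2 / 3 - stepX n) := by
      simp only [colMean, e1, e2, e3, e4]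
      push_cast
      ring
    rw [e]
    push_cast
    have h1 : 0 ≤ stepX n * (1 - stepX n) := mul_nonneg hX.le (by linarith)
    nlinarith
  · have e1 : colLegL n k = stepX n := if_neg h0
    by_cases h1 : k + 1 = 2 * n
    · have e4 : colLegR n (k + 1) = 0 := if_pos h1
      have ek : (k : ℝ) * stepX n = 1 - stepX n := by
        have : (k : ℝ) + 1 = 2 * n := by exact_mod_cast h1
        rw [← hnX, ← this]; ring
      have e : colMean n (k + 1) - colMean n k = -(stepX n * (2 / 3 - stepX n)) := by
        simp only [colMean, e1, e2, e3, e4]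
        push_cast
        linear_combination (-(4 / 3 * stepX n)) * ek
      rw [e, show 1 - stepX n * (2 * (k : ℝ) + 1) = -(1 - stepX n) by linarith]
      have h1 : 0 ≤ stepX n * (1 - stepX n) := mul_nonneg hX.le (by linarith)
      nlinarith
    · have e4 : colLegR n (k + 1) = stepX n := if_neg h1
      have e : colMean n (k + 1) - colMean n k = stepX n * (1 - stepX n * (2 * k + 1)) := by
        simp only [colMean, e1, e2, e3, e4]
        push_cast
        ring
      rw [e]
      nlinarith [mul_nonneg hX.le (sq_nonneg (1 - stepX n * (2 * (k : ℝ) + 1)))]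

lemma sum_rowWeight_sq_ge (hm : 1 ≤ m) :
    1 / 4 ≤ stepY m * ∑ j ∈ Finset.range (2 * m), rowWeight m j ^ 2 := by
  have hY := stepY_pos hm
  have hY' : stepY m ≤ 1 / 2 := stepX_le_half hm
  have h := stepY_mul hm
  simp only [rowWeight]
  rw [sum_sq_odd]
  push_cast
  generalize 2 * (m : ℝ) = N at *
  have e : stepY m * (N - 2 * stepY m * N ^ 2 + stepY m ^ 2 * (4 * N ^ 3 - N) / 3)
      = N * stepY m - 2 * (N * stepY m) ^ 2 + 4 / 3 * (N * stepY m) ^ 3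
        - (N * stepY m) * stepY m ^ 2 / 3 := by ring
  rw [e, h]
  nlinarith

/-- Riemann sum for ∫ x(1-x)(1-2x)² dx = 1/30, evaluated exactly; the products of the number of
columns and the step size are equal to 1. -/
lemma sum_profile_ge (hn : 1 ≤ n) :
    1 / 40 ≤ stepX n * ∑ k ∈ Finset.range (2 * n),
      (1 - (1 - stepX n * (2 * k + 1)) ^ 2) / 4 * (1 - stepX n * (2 * k + 1)) ^ 2 := by
  have hX := stepX_pos hn
  have hX' := stepX_le_half hn
  have h := stepX_mul hn
  have e0 : ∀ k : ℕ, (1 - (1 - stepX n * (2 * (k : ℝ) + 1)) ^ 2) / 4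
      * (1 - stepX n * (2 * k + 1)) ^ 2 = 1 / 4 * (1 - stepX n * (2 * k + 1)) ^ 2
        - 1 / 4 * (1 - stepX n * (2 * k + 1)) ^ 4 := fun k => by ring
  simp only [e0]
  rw [Finset.sum_sub_distrib, ← Finset.mul_sum, ← Finset.mul_sum, sum_sq_odd, sum_pow_four_odd]
  push_cast
  generalize 2 * (n : ℝ) = N at *
  generalize stepX n = c at *
  have e : c * (1 / 4 * (N - 2 * c * N ^ 2 + c ^ 2 * (4 * N ^ 3 - N) / 3)
      - 1 / 4 * (N - 4 * c * N ^ 2 + 2 * c ^ 2 * (4 * N ^ 3 - N) - 4 * c ^ 3 * (2 * N ^ 4 - N ^ 2)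
      + c ^ 4 * (48 * N ^ 5 - 40 * N ^ 3 + 7 * N) / 15))
      = 1 / 4 * ((N * c - 2 * (N * c) ^ 2 + 4 / 3 * (N * c) ^ 3 - N * c * c ^ 2 / 3)
      - (N * c - 4 * (N * c) ^ 2 + 8 * (N * c) ^ 3 - 2 * (N * c) * c ^ 2 - 8 * (N * c) ^ 4
      + 4 * (N * c) ^ 2 * c ^ 2 + 16 / 5 * (N * c) ^ 5 - 8 / 3 * (N * c) ^ 3 * c ^ 2
      + 7 / 15 * (N * c) * c ^ 4)) := by ring
  rw [e, h]
  have h2 : c ^ 2 ≤ 1 / 4 := by nlinarith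
  nlinarith [sq_nonneg c]

/-- Summation by parts over the columns moves the difference from the profile to the means of
x(1-x). The profile contains the factor 1-2x, the derivative of x(1-x), so every term becomes
nonnegative. -/
lemma sum_colMean_ge (hn : 1 ≤ n) :
    stepX n ^ 2 / 120 ≤ ∑ i ∈ Finset.range (2 * n + 1),
      -((colLegR n i ^ 2 * profile (i * stepX n + colLegR n i / 2)
        - colLegL n i ^ 2 * profile (i * stepX n - colLegL n i / 2)) * colMean n i) := by
  have hX := stepX_pos hn
  have hnX := stepX_mul hn
  have e1 : ∑ i ∈ Finset.range (2 * n + 1),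
      -((colLegR n i ^ 2 * profile (i * stepX n + colLegR n i / 2)
        - colLegL n i ^ 2 * profile (i * stepX n - colLegL n i / 2)) * colMean n i)
      = ∑ k ∈ Finset.range (2 * n), stepX n ^ 2 * profile (k * stepX n + stepX n / 2)
        * (colMean n (k + 1) - colMean n k) := by
    have e2 : ∑ i ∈ Finset.range (2 * n + 1),
        colLegR n i ^ 2 * profile (i * stepX n + colLegR n i / 2) * colMean n i
        = ∑ k ∈ Finset.range (2 * n), stepX n ^ 2 * profile (k * stepX n + stepX n / 2)
          * colMean n k := by
      rw [Finset.sum_range_succ]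
      have : colLegR n (2 * n) = 0 := if_pos rfl
      rw [this]
      simp only [ne_eq, OfNat.ofNat_ne_zero, not_false_eq_true, zero_pow, zero_mul, add_zero]
      refine Finset.sum_congr rfl fun k hk => ?_
      have : colLegR n k = stepX n := if_neg (by have := Finset.mem_range.1 hk; omega)
      rw [this]
    have e3 : ∑ i ∈ Finset.range (2 * n + 1),
        colLegL n i ^ 2 * profile (i * stepX n - colLegL n i / 2) * colMean n i
        = ∑ k ∈ Finset.range (2 * n), stepX n ^ 2 * profile (k * stepX n + stepX n / 2)
          * colMean n (k + 1) := by
      rw [Finset.sum_range_succ']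
      have : colLegL n 0 = 0 := if_pos rfl
      rw [this]
      simp only [ne_eq, OfNat.ofNat_ne_zero, not_false_eq_true, zero_pow, zero_mul, add_zero]
      refine Finset.sum_congr rfl fun k hk => ?_
      have : colLegL n (k + 1) = stepX n := if_neg (by omega)
      rw [this]
      push_cast
      rw [show ((k : ℝ) + 1) * stepX n - stepX n / 2 = k * stepX n + stepX n / 2 by ring]
    simp only [sub_mul, mul_sub, Finset.sum_neg_distrib, Finset.sum_sub_distrib]
    rw [e2, e3]
    ring
  rw [e1]
  have h1 := sum_profile_ge hn
  calc stepX n ^ 2 / 120 = stepX n ^ 2 / 3 * (1 / 40) := by ring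
    _ ≤ stepX n ^ 2 / 3 * (stepX n * ∑ k ∈ Finset.range (2 * n),
      (1 - (1 - stepX n * (2 * k + 1)) ^ 2) / 4 * (1 - stepX n * (2 * k + 1)) ^ 2) := by gcongr
    _ = ∑ k ∈ Finset.range (2 * n), stepX n ^ 2 * ((1 - (1 - stepX n * (2 * k + 1)) ^ 2) / 4
        * (stepX n / 3 * (1 - stepX n * (2 * k + 1)) ^ 2)) := by
      rw [Finset.mul_sum, Finset.mul_sum]
      exact Finset.sum_congr rfl fun k _ => by ring
    _ ≤ _ := by
      refine Finset.sum_le_sum fun k hk => ?_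
      have hk' := Finset.mem_range.1 hk
      have h2 := colMean_sub_ge hn hk'
      have h3 : 0 ≤ (1 - (1 - stepX n * (2 * (k : ℝ) + 1)) ^ 2) / 4 := by
        have : ((k : ℝ) + 1) ≤ 2 * n := by exact_mod_cast hk'
        have h4 : (0 : ℝ) ≤ k := Nat.cast_nonneg _
        have h5 : (1 - stepX n * (2 * (k : ℝ) + 1)) ^ 2 ≤ 1 := by
          rw [sq_le_one_iff_abs_le_one, abs_le]
          constructor <;> nlinarith
        linarith
      have h6 := mul_le_mul_of_nonneg_left h2 h3
      calc _ ≤ stepX n ^ 2 * _ := mul_le_mul_of_nonneg_left h6 (sq_nonneg _)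
        _ = _ := by simp only [profile]; ring

/-- Replacing 1-2y by its row value costs at most Y · κ/4 = X²/4 pointwise. The remaining sum is a
product of a column sum and a row sum. -/
lemma sum_vertical_ge (hn : 1 ≤ n) (hm : 1 ≤ m) :
    stepX n ^ 2 / stepY m / 480 - 3 / 8 * stepX n ^ 2
      ≤ ∑ t : TriIndex n m, ∫ x in cell (triangulation n m) t,
        (gradU x).2 * (testGrad t).2 := by
  have hX := stepX_pos hn
  have hY := stepY_pos hm
  have h1 : ∀ t : TriIndex n m, ∫ x in cell (triangulation n m) t, (gradU x).2 * (testGrad t).2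
      = (∫ x in cell (triangulation n m) t,
          x.1 * (1 - x.1) * (1 - 2 * x.2 - rowWeight m (row t)) * (testGrad t).2)
        + rowWeight m (row t) * (testGrad t).2
          * ∫ x in cell (triangulation n m) t, x.1 * (1 - x.1) := by
    intro t
    rw [← integral_const_mul, ← integral_add]
    · congr 1
      funext x
      simp only [gradU]
      ring
    · exact integrableOn_cell _ t (by fun_prop)
    · exact integrableOn_cell _ t (by fun_prop)
  have h2 : |∑ t : TriIndex n m, ∫ x in cell (triangulation n m) t,
      x.1 * (1 - x.1) * (1 - 2 * x.2 - rowWeight m (row t)) * (testGrad t).2|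
      ≤ 3 / 2 * (stepX n ^ 2 / 4) := by
    refine sum_integral_le hn hm (by positivity) fun t x hx => ?_
    obtain ⟨⟨h3, h4⟩, -⟩ := cell_mem_unitSquare hn hm hx
    obtain ⟨⟨-, h5⟩, -, h6⟩ := cell_subset t hx
    simp only at h5 h6
    have e1 : |x.1 * (1 - x.1)| ≤ 1 / 4 := by
      rw [abs_of_nonneg (mul_nonneg h3 (by linarith))]
      nlinarith [sq_nonneg (x.1 - 1 / 2)]
    have e2 : |1 - 2 * x.2 - rowWeight m (row t)| ≤ stepY m := by
      rw [rowWeight, abs_le]; constructor <;> linarith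
    rw [abs_mul, abs_mul]
    calc _ ≤ 1 / 4 * stepY m * (stepX n ^ 2 / stepY m) := by
          have := abs_testGrad_snd_le hn hm t
          gcongr
      _ = stepX n ^ 2 / 4 := by field_simp
  have h3 : ∑ t : TriIndex n m, rowWeight m (row t) * (testGrad t).2
      * ∫ x in cell (triangulation n m) t, x.1 * (1 - x.1)
      = (∑ i ∈ Finset.range (2 * n + 1),
        -((colLegR n i ^ 2 * profile (i * stepX n + colLegR n i / 2)
        - colLegL n i ^ 2 * profile (i * stepX n - colLegL n i / 2)) * colMean n i))
        * ∑ j ∈ Finset.range (2 * m), rowWeight m j ^ 2 := by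
    rw [Finset.sum_mul_sum, ← sum_triIndex (fun i j =>
      -((colLegR n i ^ 2 * profile (i * stepX n + colLegR n i / 2)
        - colLegL n i ^ 2 * profile (i * stepX n - colLegL n i / 2)) * colMean n i)
        * rowWeight m j ^ 2)]
    refine Finset.sum_congr rfl fun t _ => ?_
    have e1 : colLegL n t.1.1 = legL t := rfl
    have e2 : colLegR n t.1.1 = legR t := rfl
    rw [integral_colMean hn hm, e1, e2]
    have := testGrad_snd hn hm t
    linear_combination (rowWeight m (row t) * colMean n t.1.1) * this
  have h4 : stepX n ^ 2 / stepY m / 480 ≤ (∑ i ∈ Finset.range (2 * n + 1),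
        -((colLegR n i ^ 2 * profile (i * stepX n + colLegR n i / 2)
        - colLegL n i ^ 2 * profile (i * stepX n - colLegL n i / 2)) * colMean n i))
        * ∑ j ∈ Finset.range (2 * m), rowWeight m j ^ 2 := by
    have e1 : 1 / 4 / stepY m ≤ ∑ j ∈ Finset.range (2 * m), rowWeight m j ^ 2 := by
      rw [div_le_iff₀ hY, mul_comm]
      exact sum_rowWeight_sq_ge hm
    calc stepX n ^ 2 / stepY m / 480 = stepX n ^ 2 / 120 * (1 / 4 / stepY m) := by ring
      _ ≤ _ := mul_le_mul (sum_colMean_ge hn) e1 (by positivity)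
        ((by positivity : (0 : ℝ) ≤ stepX n ^ 2 / 120).trans (sum_colMean_ge hn))
  simp only [h1]
  rw [Finset.sum_add_distrib, h3]
  have := (abs_le.1 h2).1
  linarith

/-! ### Duality with the test function. -/

lemma sum_error_testGrad_ge (hn : 1 ≤ n) (hnm : n ≤ m)
    {σ : TriIndex n m → ℝ × ℝ → ℝ × ℝ} {p : TriIndex n m → ℝ}
    (hσ : IsMixedSolution (triangulation n m) modelF σ p) :
    stepX n ^ 2 / stepY m / 480 - 3 * stepX n
      ≤ ∑ t, ∫ x in cell (triangulation n m) t, dot (grad modelU x - σ t x) (testGrad t) := by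
  have hm : 1 ≤ m := hn.trans hnm
  have hX := stepX_pos hn
  have hX' := stepX_le_half hn
  have hc := continuous_gradU
  have h1 : ∀ t, ∫ x in cell (triangulation n m) t, dot (grad modelU x - σ t x) (testGrad t)
      = (∫ x in cell (triangulation n m) t, (gradU x).1 * (testGrad t).1)
        + (∫ x in cell (triangulation n m) t, (gradU x).2 * (testGrad t).2)
        - ∫ x in cell (triangulation n m) t, dot (σ t x) (testGrad t) := by
    intro t
    rw [grad_modelU, integral_dot_sub hc (continuous_of_mem hσ.1 t) continuous_const]
    congr 1
    simp only [dot]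
    exact integral_add (integrableOn_cell _ t (by fun_prop)) (integrableOn_cell _ t (by fun_prop))
  simp only [h1]
  rw [Finset.sum_sub_distrib, Finset.sum_add_distrib]
  have h2 := (abs_le.1 (abs_sum_flux_testGrad_le hn hm hσ)).2
  have h3 := (abs_le.1 (abs_sum_horizontal_le hn hnm)).1
  have h4 := sum_vertical_ge hn hm
  nlinarith

/-- Cauchy-Schwarz in the form |e - c ∇v|² ≥ 0, with the multiplier c left free to be optimised. -/
lemma fluxError_sq (hn : 1 ≤ n) (hm : 1 ≤ m) {σ : TriIndex n m → ℝ × ℝ → ℝ × ℝ} (c : ℝ)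
    (hσ : σ ∈ raviartThomas (triangulation n m)) :
    2 * c * (∑ t, ∫ x in cell (triangulation n m) t, dot (grad modelU x - σ t x) (testGrad t))
      - c ^ 2 * (2 * (1 + (stepX n ^ 2 / stepY m) ^ 2))
      ≤ fluxError (triangulation n m) modelU σ ^ 2 := by
  have hT := nondegenerate_triangulation hn hm
  rw [fluxError, Real.sq_sqrt
    (Finset.sum_nonneg fun t _ => integral_cell_nonneg _ t fun x => dot_self_nonneg _)]
  have h1 : ∀ t, 2 * c * (∫ x in cell (triangulation n m) t,
      dot (grad modelU x - σ t x) (testGrad t))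
      - ∫ x in cell (triangulation n m) t, c ^ 2 * dot (testGrad t) (testGrad t)
      ≤ ∫ x in cell (triangulation n m) t,
        dot (grad modelU x - σ t x) (grad modelU x - σ t x) := by
    intro t
    have hc := continuous_error hσ t
    have i1 : IntegrableOn (fun x => 2 * c * dot (grad modelU x - σ t x) (testGrad t))
        (cell (triangulation n m) t) :=
      integrableOn_cell _ t ((continuous_dot hc continuous_const).const_mul _)
    have i2 : IntegrableOn (fun _ => c ^ 2 * dot (testGrad t) (testGrad t))
        (cell (triangulation n m) t) := integrableOn_cell _ t continuous_const
    rw [← integral_const_mul, ← integral_sub i1 i2]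
    refine setIntegral_mono_on (i1.sub i2) (integrableOn_cell _ t (continuous_dot hc hc))
      (measurableSet_cell _ t) fun x _ => ?_
    have := dot_self_nonneg (grad modelU x - σ t x - c • testGrad t)
    simp only [dot, Prod.fst_sub, Prod.snd_sub, Prod.smul_fst, Prod.smul_snd, smul_eq_mul] at *
    linarith
  have h2 := Finset.sum_le_sum fun t (_ : t ∈ Finset.univ) => h1 t
  rw [Finset.sum_sub_distrib, ← Finset.mul_sum] at h2
  have h3 := (abs_le.1 (sum_integral_le hn hm
    (g := fun t _ => c ^ 2 * dot (testGrad t) (testGrad t))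
    (M := c ^ 2 * (1 / 4 + (stepX n ^ 2 / stepY m) ^ 2)) (by positivity) ?_)).2
  · nlinarith [sq_nonneg (c * (stepX n ^ 2 / stepY m)), sq_nonneg c]
  · intro t x _
    have e1 := abs_le.1 (abs_testGrad_fst_le hn hm t)
    have e2 := abs_le.1 (abs_testGrad_snd_le hn hm t)
    have e3 := sq_le_sq' e1.1 e1.2
    have e4 := sq_le_sq' e2.1 e2.2
    rw [abs_of_nonneg (mul_nonneg (sq_nonneg c) (dot_self_nonneg _))]
    refine mul_le_mul_of_nonneg_left ?_ (sq_nonneg c)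
    simp only [dot]
    nlinarith

theorem le_fluxError (hn : 1 ≤ n) (hnm : n ≤ m) (hε : (n : ℝ) / m ≤ 1 / 2880)
    {σ : TriIndex n m → ℝ × ℝ → ℝ × ℝ} (hσ : IsMixedFlux (triangulation n m) modelF σ) :
    1 / 3840 * min 1 ((m : ℝ) / (n : ℝ) ^ 2) ≤ fluxError (triangulation n m) modelU σ := by
  have hm : 1 ≤ m := hn.trans hnm
  obtain ⟨p, hp⟩ := hσ
  have hX := stepX_pos hn
  have hY := stepY_pos hm
  have h1 := sum_error_testGrad_ge hn hnm hp
  -- The threshold for n/m makes the perturbation 3X at most κ/960, half of the main term κ/480.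
  have h2 : stepX n ≤ 1 / 2880 * (stepX n ^ 2 / stepY m) := by
    have e : stepX n = (n : ℝ) / m * (stepX n ^ 2 / stepY m) := by
      have h3 : (n : ℝ) ≠ 0 := by exact_mod_cast (by omega : n ≠ 0)
      have h4 : (m : ℝ) ≠ 0 := by exact_mod_cast (by omega : m ≠ 0)
      unfold stepX stepY
      field_simp
    calc stepX n = (n : ℝ) / m * (stepX n ^ 2 / stepY m) := e
      _ ≤ _ := by gcongr
  have h5 : (m : ℝ) / (n : ℝ) ^ 2 = 2 * (stepX n ^ 2 / stepY m) := by
    rw [sq_div_eq hn hm]; ring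
  have hκ : 0 < stepX n ^ 2 / stepY m := by positivity
  -- This c maximises 2cS - 2c²(1+κ²) at S = κ/960.
  have h6 := fluxError_sq hn hm (stepX n ^ 2 / stepY m
    / (1920 * (1 + (stepX n ^ 2 / stepY m) ^ 2))) hp.1
  rw [h5]
  have h7 : 0 ≤ fluxError (triangulation n m) modelU σ := Real.sqrt_nonneg _
  generalize (∑ t, ∫ x in cell (triangulation n m) t,
    dot (grad modelU x - σ t x) (testGrad t)) = S at *
  generalize fluxError (triangulation n m) modelU σ = E at *
  generalize stepX n ^ 2 / stepY m = κ at *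
  have h8 : κ / 960 ≤ S := by linarith
  have h9 : κ ^ 2 / (1843200 * (1 + κ ^ 2)) ≤ E ^ 2 := by
    refine le_trans ?_ h6
    calc κ ^ 2 / (1843200 * (1 + κ ^ 2)) = 2 * (κ / (1920 * (1 + κ ^ 2))) * (κ / 960)
          - (κ / (1920 * (1 + κ ^ 2))) ^ 2 * (2 * (1 + κ ^ 2)) := by field_simp; norm_num
      _ ≤ _ := by gcongr
  refine abs_le_of_sq_le_sq' ?_ h7 |>.2
  refine le_trans ?_ h9
  rw [le_div_iff₀ (by positivity)]
  have h10 : min 1 (2 * κ) ≤ 1 := min_le_left _ _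
  have h11 : min 1 (2 * κ) ≤ 2 * κ := min_le_right _ _
  have h12 : 0 ≤ min 1 (2 * κ) := le_min zero_le_one (by linarith)
  generalize min 1 (2 * κ) = μ at *
  have h13 : μ ^ 2 ≤ 1 := by nlinarith
  have h14 : μ ^ 2 ≤ 4 * κ ^ 2 := by nlinarith
  have h15 : μ ^ 2 * κ ^ 2 ≤ κ ^ 2 := by nlinarith [sq_nonneg κ]
  nlinarith

end Lower

end RTMixed

theorem mainTheorem2 :
    ∃ ε C' C : ℝ, 0 < ε ∧ 0 < C' ∧ 0 < C ∧
      ∀ n m : ℕ, 1 ≤ n → n ≤ m →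
        ∃ σ : RTMixed.TriIndex n m → ℝ × ℝ → ℝ × ℝ,
          (∀ σ' : RTMixed.TriIndex n m → ℝ × ℝ → ℝ × ℝ,
            RTMixed.IsMixedFlux (RTMixed.triangulation n m) RTMixed.modelF σ' ↔ σ' = σ) ∧
          RTMixed.fluxError (RTMixed.triangulation n m) RTMixed.modelU σ
            ≤ C * min 1 ((m : ℝ) / (n : ℝ) ^ 2) ∧
          ((n : ℝ) / (m : ℝ) ≤ ε →
            C' * min 1 ((m : ℝ) / (n : ℝ) ^ 2)
              ≤ RTMixed.fluxError (RTMixed.triangulation n m) RTMixed.modelU σ) := by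
  refine ⟨1 / 2880, 1 / 3840, 174, by norm_num, by norm_num, by norm_num, fun n m hn hnm => ?_⟩
  have hT := RTMixed.nondegenerate_triangulation hn (hn.trans hnm)
  -- The interpolated horizontal field serves as a particular solution of the discrete divergence
  -- equation.
  obtain ⟨σ, hσ⟩ := RTMixed.exists_isMixedFlux hT (RTMixed.interpolant_mem hT RTMixed.horizField)
    (RTMixed.integral_div_interpolant hT RTMixed.edgeFlux_horizField)
  exact ⟨σ, fun σ' => ⟨fun h => hσ.unique hT h, fun h => h ▸ hσ⟩, RTMixed.fluxError_le hn hnm hσ,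
    fun hε => RTMixed.le_fluxError hn hnm hε hσ⟩
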